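/- Let $\mathcal X,\mathcal Y,\mathcal Z$ be finite sets, $\mathcal X\neq\emptyset$, and let $W:\mathcal X\to\mathcal Y\times\mathcal Z$ be a discrete memoryless wiretap channel: on input $x$ the receiver gets $Y$ and the eavesdropper gets $Z$ with probability $W(Y,Z|x)$. A wiretap code of length $n$ with $N$ messages and noiseless public feedback consists of a countable feedback alphabet $\mathcal F$, private randomness $U_x$ of the transmitter and $U_y$ of the receiver, encoders $e_t$ ($1\le t\le n$), feedback maps $f_t$ ($0\le t\le n-1$) and a decoder $d$. The message $M$ is uniform on $\{1,\dots,N\}$; $M,U_x,U_y$ are independent. The receiver sends $F_0=f_0(U_y)$; for $t=1,\dots,n$ the transmitter sends $X_t=e_t(M,U_x,F_0,\dots,F_{t-1})$, the channel outputs $(Y_t,Z_t)\sim W(\cdot,\cdot|X_t)$, and, if $t<n$, the receiver sends $F_t=f_t(Y_1,\dots,Y_t,U_y)$; finally the receiver decodes $\hat M=d(Y_1,\dots,Y_n,U_y)$. Write $\mathbf F=(F_0,\dots,F_{n-1})$. The code is an $(N,n,\epsilon,\delta)$ wiretap code if $$\Pr(M\ne\hat M)\le\epsilon,\qquad \tfrac12\sum_{m,z^n,\mathbf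 f}\bigl|P_{MZ^n\mathbf F}(m,z^n,\mathbf f)-P_M(m)P_{Z^n\mathbf F}(z^n,\mathbf f)\bigr|\le\delta .$$ A rate $R>0$ is $(\epsilon,\delta)$-achievable if an $(\lfloor 2^{nR}\rfloor,n,\epsilon,\delta)$ wiretap code exists for all sufficiently large $n$, and the $(\epsilon,\delta)$-wiretap capacity $C_{\epsilon,\delta}$ is the supremum of all achievable rates ($0$ if there is none). Theorem. For all $\epsilon,\delta\ge 0$ with $\epsilon+\delta<1$, $$C_{\epsilon,\delta}\le\max_{P_X} I(X\wedge Y|Z),$$ where the maximum, which is attained, is over all probability distributions $P_X$ on $\mathcal X$, the joint law of $(X,Y,Z)$ is $P_X(x)W(y,z|x)$, and the conditional mutual information is in bits. -/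

import Mathlib

/-- The conditional mutual information `I(X ∧ Y | Z)`, in bits, of a joint probability mass function
`p x y z` on finite alphabets, i.e.
`∑ p(x,y,z) log₂ (p(x,y,z) p(z) / (p(x,z) p(y,z)))`.
A term with `p(x,y,z) = 0` is `0`; in any other term all marginals are positive. -/
noncomputable def condMutualInfo {X Y Z : Type*} [Fintype X] [Fintype Y] [Fintype Z]
    (p : X → Y → Z → ℝ) : ℝ :=
  ∑ x, ∑ y, ∑ z, p x y z *
    Real.logb 2 ((p x y z * ∑ x', ∑ y', p x' y' z) / ((∑ y', p x y' z) * ∑ x', p x' y z))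

/-- The variation distance `(1/2) ∑ₐ |p(a) - q(a)|` of two probability mass functions. -/
noncomputable def variationDist {A : Type*} (p q : A → ℝ) : ℝ :=
  (1 / 2) * ∑' a, |p a - q a|

/-- A randomized wiretap code of length `n` with `N` messages and noiseless public feedback, for a
channel with input alphabet `X` and receiver's output alphabet `Y`.

The transmitter holds local randomness `u` with law `lawT`, the receiver holds local randomness `v`
with law `lawR`, on arbitrary probability spaces. The feedback alphabet `F` is countable.
Times are `0`-based: `t : Fin n` stands for the `(t+1)`-st transmission, so that
* `enc t m f u` is the channel input of that transmission; it depends on the message `m` and on the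
  `t+1` feedback symbols `F_0, …, F_t` received so far;
* `fb t y v` is the feedback symbol `F_t`; it depends on the `t` channel outputs seen so far;
* `dec y v` is the decoded message. -/
structure WiretapCode (X Y : Type*) (N n : ℕ) where
  F : Type
  countableF : Countable F
  T : Type
  R : Type
  measT : MeasurableSpace T
  measR : MeasurableSpace R
  lawT : MeasureTheory.Measure T
  lawR : MeasureTheory.Measure R
  probT : MeasureTheory.IsProbabilityMeasure lawT
  probR : MeasureTheory.IsProbabilityMeasure lawR
  enc : (t : Fin n) → Fin N → (Fin (t + 1) → F) → T → X
  fb : (t : Fin n) → (Fin t → Y) → R → F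
  dec : (Fin n → Y) → R → Fin N
  measurable_enc : ∀ t m f x, MeasurableSet {u : T | enc t m f u = x}
  measurable_fb : ∀ t y a, MeasurableSet {v : R | fb t y v = a}
  measurable_dec : ∀ y m, MeasurableSet {v : R | dec y v = m}

namespace WiretapCode

variable {X Y Z : Type*} {N n : ℕ}

attribute [instance] countableF measT measR probT probR

/-- The overall feedback communication `(F_0, …, F_{n-1})`, where `F_t = f_t(Y_1, …, Y_t)`. -/
def feedback (c : WiretapCode X Y N n) (v : c.R) (y : Fin n → Y) (t : Fin n) : c.F :=
  c.fb t (fun i => y ⟨i, i.2.trans t.2⟩) v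

/-- The channel inputs `(X_1, …, X_n)`; each is determined by the message, the local randomness
and the feedback communication up to that time. -/
def input (c : WiretapCode X Y N n) (m : Fin N) (u : c.T) (v : c.R) (y : Fin n → Y)
    (t : Fin n) : X :=
  c.enc t m (fun i => c.feedback v y ⟨i, (Nat.lt_succ_iff.mp i.2).trans_lt t.2⟩) u

open scoped Classical in
/-- The probability of an event when the code is used over the memoryless channel `W`. The message
is uniform, the two local randomnesses are independent of it and of each other, and given all of
these the outputs have the conditional probability `∏ₜ W(yₜ, zₜ | xₜ)`, where `xₜ` depends only on
the outputs before time `t`. -/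
noncomputable def prob [Fintype Y] [Fintype Z] (c : WiretapCode X Y N n)
    (W : X → stdSimplex ℝ (Y × Z))
    (E : Fin N → c.T → c.R → (Fin n → Y) → (Fin n → Z) → Prop) : ℝ :=
  (1 / (N : ℝ)) * ∑ m : Fin N, ∫ w : c.T × c.R, ∑ y : Fin n → Y, ∑ z : Fin n → Z,
    (if E m w.1 w.2 y z then
      ∏ t, (W (c.input m w.1 w.2 y t) : Y × Z → ℝ) (y t, z t) else 0)
    ∂(c.lawT.prod c.lawR)

variable [Fintype Y] [Fintype Z]

/-- The probability of error `P(M ≠ M̂)`. -/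
noncomputable def errorProb (c : WiretapCode X Y N n) (W : X → stdSimplex ℝ (Y × Z)) : ℝ :=
  c.prob W fun m _ v y _ => m ≠ c.dec y v

/-- The joint law of the message `M`, the eavesdropper's outputs `Zⁿ` and the feedback `𝐅`. -/
noncomputable def lawMZF (c : WiretapCode X Y N n) (W : X → stdSimplex ℝ (Y × Z))
    (a : Fin N × (Fin n → Z) × (Fin n → c.F)) : ℝ :=
  c.prob W fun m _ v y z => m = a.1 ∧ z = a.2.1 ∧ c.feedback v y = a.2.2

/-- The law of the message `M`. -/
noncomputable def lawM (c : WiretapCode X Y N n) (W : X → stdSimplex ℝ (Y × Z))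
    (a : Fin N) : ℝ :=
  c.prob W fun m _ _ _ _ => m = a

/-- The joint law of the eavesdropper's observations, `Zⁿ` and `𝐅`. -/
noncomputable def lawZF (c : WiretapCode X Y N n) (W : X → stdSimplex ℝ (Y × Z))
    (a : (Fin n → Z) × (Fin n → c.F)) : ℝ :=
  c.prob W fun _ _ v y z => z = a.1 ∧ c.feedback v y = a.2

/-- `c` is an `(N, n, ε, δ)` wiretap code for the channel `W`. -/
def IsGood (c : WiretapCode X Y N n) (W : X → stdSimplex ℝ (Y × Z)) (ε δ : ℝ) : Prop :=
  c.errorProb W ≤ ε ∧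
    variationDist (c.lawMZF W) (fun a => c.lawM W a.1 * c.lawZF W a.2) ≤ δ

end WiretapCode

/-- A rate `R > 0` is `(ε, δ)`-achievable over the wiretap channel `W` with public feedback if
there is a `(⌊2^{nR}⌋, n, ε, δ)` wiretap code for all sufficiently large `n`. -/
def IsAchievableRate {X Y Z : Type*} [Fintype Y] [Fintype Z]
    (W : X → stdSimplex ℝ (Y × Z)) (ε δ R : ℝ) : Prop :=
  0 < R ∧ ∀ᶠ n : ℕ in Filter.atTop,
    ∃ c : WiretapCode X Y ⌊(2 : ℝ) ^ ((n : ℝ) * R)⌋₊ n, c.IsGood W ε δ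

/-- The `(ε, δ)`-wiretap capacity with public feedback: the supremum of the achievable rates, in
`[0, ∞]` (it is `0` if no positive rate is achievable). -/
noncomputable def wiretapCapacity {X Y Z : Type*} [Fintype Y] [Fintype Z]
    (W : X → stdSimplex ℝ (Y × Z)) (ε δ : ℝ) : ENNReal :=
  ⨆ (R : ℝ) (_ : IsAchievableRate W ε δ R), ENNReal.ofReal R

/-- `I(X ∧ Y | Z)` when `X` has law `P` and `(Y, Z)` is the output of the channel `W`
for the input `X`. -/
noncomputable def channelCondMutualInfo {X Y Z : Type*} [Fintype X] [Fintype Y] [Fintype Z]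
    (W : X → stdSimplex ℝ (Y × Z)) (P : stdSimplex ℝ X) : ℝ :=
  condMutualInfo fun x y z => (P : X → ℝ) x * (W x : Y × Z → ℝ) (y, z)

/-! The code is compared with its run over a channel `V` under which the receiver's output is a
degraded version of the eavesdropper's: `V(y,z|x) = A(x,z) B(y,z)`, where `A` is the eavesdropper's
law and `B` the kernel of `Y` given `Z` induced by an input law `P`. Two facts make `V` useful.

`V` is close to `W`. The average over `P` of the divergence of `W` from `V` is `I(X ∧ Y | Z)` in
nats, so a near-maximizing `P` of full support makes the divergence at most `C log 2 + g` for every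
single input (`exists_outputDivergence_le`). A Chernoff bound that tolerates adaptive inputs then
gives `P_W(E) ≤ L P_V(E)` up to an exponentially small term, with `L` about `2^{nC}`
(`prob_le_change_of_measure`).

`V` carries no secret. The transmitter sees the receiver only through the public feedback, so under
`V` the message and the decoded message are conditionally independent given `(Zⁿ, 𝐅)`
(`prob_and_public_eq`). They may still agree if the observations reveal the message; but by
Cauchy–Schwarz only a fraction `η` of the messages can have a large agreement probability
(`card_mul_le_one_of_lt_mul`), and under `W` secrecy lets the true message be one of these with
probability at most `δ + η`. All other correct decodings have `V`-probability at most `1/(N η²)`.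

Hence `1 ≤ ε + δ + η + o(1) + L/(N η²)` (`one_le_of_isGood`), which fails for large `n` if `N` grows
at a rate above `C` and `ε + δ + η < 1`. -/

/-! ### Continuity of the conditional mutual information -/

/-- Terms `t log t` extend continuously to `t = 0`, whereas the ratio inside the original logarithm
does not; this form yields continuity on the whole simplex. -/
lemma condMutualInfo_eq_entropies {X Y Z : Type*} [Fintype X] [Fintype Y] [Fintype Z]
    (p : X → Y → Z → ℝ) (hp : ∀ x y z, 0 ≤ p x y z) :
    condMutualInfo p = ((∑ x, ∑ y, ∑ z, p x y z * Real.log (p x y z))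
      + (∑ z, (∑ x, ∑ y, p x y z) * Real.log (∑ x, ∑ y, p x y z))
      - (∑ x, ∑ z, (∑ y, p x y z) * Real.log (∑ y, p x y z))
      - (∑ y, ∑ z, (∑ x, p x y z) * Real.log (∑ x, p x y z))) / Real.log 2 := by
  have key : ∀ x y z, p x y z *
      Real.logb 2 ((p x y z * ∑ x', ∑ y', p x' y' z) / ((∑ y', p x y' z) * ∑ x', p x' y z))
      = (p x y z * Real.log (p x y z) + p x y z * Real.log (∑ x', ∑ y', p x' y' z)
        - p x y z * Real.log (∑ y', p x y' z) - p x y z * Real.log (∑ x', p x' y z))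
        / Real.log 2 := by
    intro x y z
    rcases (hp x y z).eq_or_lt with h0 | h0
    · simp [← h0]
    · have h1 : 0 < ∑ y', p x y' z :=
        h0.trans_le (Finset.single_le_sum (f := fun y' => p x y' z)
          (fun i _ => hp x i z) (Finset.mem_univ y))
      have h2 : 0 < ∑ x', p x' y z :=
        h0.trans_le (Finset.single_le_sum (f := fun x' => p x' y z)
          (fun i _ => hp i y z) (Finset.mem_univ x))
      have h3 : 0 < ∑ x', ∑ y', p x' y' z :=
        h1.trans_le (Finset.single_le_sum (f := fun x' => ∑ y', p x' y' z)
          (fun i _ => Finset.sum_nonneg fun j _ => hp i j z) (Finset.mem_univ x))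
      rw [Real.logb, Real.log_div (by positivity) (by positivity), Real.log_mul h0.ne' h3.ne',
        Real.log_mul h1.ne' h2.ne']
      ring
  unfold condMutualInfo
  simp_rw [key, ← Finset.sum_div, Finset.sum_sub_distrib, Finset.sum_add_distrib]
  congr 1
  have e1 : ∑ x, ∑ y, ∑ z, p x y z * Real.log (∑ x', ∑ y', p x' y' z)
      = ∑ z, (∑ x, ∑ y, p x y z) * Real.log (∑ x, ∑ y, p x y z) := by
    simp_rw [Finset.sum_mul]
    rw [Finset.sum_comm' (t' := Finset.univ) (s' := fun _ => Finset.univ) (by simp)]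
    rw [Finset.sum_congr rfl fun y _ => Finset.sum_comm, Finset.sum_comm]
    exact Finset.sum_congr rfl fun z _ => Finset.sum_comm
  have e2 : ∑ x, ∑ y, ∑ z, p x y z * Real.log (∑ y', p x y' z)
      = ∑ x, ∑ z, (∑ y, p x y z) * Real.log (∑ y, p x y z) := by
    simp_rw [Finset.sum_mul]
    exact Finset.sum_congr rfl fun x _ => Finset.sum_comm
  have e3 : ∑ x, ∑ y, ∑ z, p x y z * Real.log (∑ x', p x' y z)
      = ∑ y, ∑ z, (∑ x, p x y z) * Real.log (∑ x, p x y z) := by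
    simp_rw [Finset.sum_mul]
    rw [Finset.sum_comm]
    exact Finset.sum_congr rfl fun x _ => Finset.sum_comm
  rw [e1, e2, e3]

lemma continuous_channelCondMutualInfo {X Y Z : Type*} [Fintype X] [Fintype Y] [Fintype Z]
    (W : X → stdSimplex ℝ (Y × Z)) : Continuous (channelCondMutualInfo W) := by
  have h : channelCondMutualInfo W = _ := funext fun P => condMutualInfo_eq_entropies
    (fun x y z => (P : X → ℝ) x * (W x : Y × Z → ℝ) (y, z))
    fun x y z => mul_nonneg (P.2.1 x) ((W x).2.1 _)
  rw [h]
  have hc : ∀ x, Continuous fun P : stdSimplex ℝ X => (P : X → ℝ) x :=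
    fun x => (continuous_apply x).comp continuous_subtype_val
  have hl : ∀ f : stdSimplex ℝ X → ℝ, Continuous f → Continuous fun P => f P * Real.log (f P) :=
    fun f hf => Real.continuous_mul_log.comp hf
  refine Continuous.div_const (((Continuous.add ?_ ?_).sub ?_).sub ?_) _
  · refine continuous_finsetSum _ fun x _ => continuous_finsetSum _ fun y _ =>
      continuous_finsetSum _ fun z _ => hl _ ((hc x).mul continuous_const)
  · refine continuous_finsetSum _ fun z _ => hl _ ?_
    exact continuous_finsetSum _ fun x _ => continuous_finsetSum _ fun y _ =>
      (hc x).mul continuous_const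
  · refine continuous_finsetSum _ fun x _ => continuous_finsetSum _ fun z _ => hl _ ?_
    exact continuous_finsetSum _ fun y _ => (hc x).mul continuous_const
  · refine continuous_finsetSum _ fun y _ => continuous_finsetSum _ fun z _ => hl _ ?_
    exact continuous_finsetSum _ fun x _ => (hc x).mul continuous_const

/-! ### The degraded comparison channel and the Kuhn–Tucker conditions -/

section OutputKernel

variable {X Y Z : Type*} [Fintype Y] [Fintype Z]

/-- The law of the pair of outputs of the channel `W` for an input of law `P`. -/
noncomputable def outputLaw [Fintype X] (W : X → stdSimplex ℝ (Y × Z)) (P : X → ℝ)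
    (y : Y) (z : Z) : ℝ :=
  ∑ x, P x * (W x : Y × Z → ℝ) (y, z)

/-- The conditional law of the receiver's output given the eavesdropper's output, for an input
of law `P`. -/
noncomputable def outputKernel [Fintype X] (W : X → stdSimplex ℝ (Y × Z)) (P : X → ℝ)
    (y : Y) (z : Z) : ℝ :=
  outputLaw W P y z / ∑ y', outputLaw W P y' z

/-- The law of the eavesdropper's output for the input `x`. -/
noncomputable def eavesdropperLaw (W : X → stdSimplex ℝ (Y × Z)) (x : X) (z : Z) : ℝ :=
  ∑ y, (W x : Y × Z → ℝ) (y, z)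

/-- The divergence, in nats, of the channel `W` for the input `x` from the channel that degrades
the eavesdropper's output by `outputKernel W P`. -/
noncomputable def outputDivergence [Fintype X] (W : X → stdSimplex ℝ (Y × Z)) (P : X → ℝ)
    (x : X) : ℝ :=
  ∑ y, ∑ z, (W x : Y × Z → ℝ) (y, z) * Real.log ((W x : Y × Z → ℝ) (y, z) /
    (eavesdropperLaw W x z * outputKernel W P y z))

variable (W : X → stdSimplex ℝ (Y × Z))

lemma channel_nonneg (x : X) (a : Y × Z) : 0 ≤ (W x : Y × Z → ℝ) a := (W x).2.1 a

lemma channel_sum (x : X) : ∑ y, ∑ z, (W x : Y × Z → ℝ) (y, z) = 1 := by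
  rw [← Fintype.sum_prod_type']; exact (W x).2.2

lemma eavesdropperLaw_nonneg (x : X) (z : Z) : 0 ≤ eavesdropperLaw W x z :=
  Finset.sum_nonneg fun _ _ => (W x).2.1 _

variable {W} in
lemma eavesdropperLaw_pos {x : X} {y : Y} {z : Z} (h : 0 < (W x : Y × Z → ℝ) (y, z)) :
    0 < eavesdropperLaw W x z :=
  h.trans_le (Finset.single_le_sum (f := fun y => (W x : Y × Z → ℝ) (y, z))
    (fun _ _ => (W x).2.1 _) (Finset.mem_univ y))

variable [Fintype X]

lemma outputLaw_nonneg {P : X → ℝ} (hP : ∀ x, 0 < P x) (y : Y) (z : Z) :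
    0 ≤ outputLaw W P y z :=
  Finset.sum_nonneg fun x _ => mul_nonneg (hP x).le ((W x).2.1 _)

lemma outputKernel_nonneg {P : X → ℝ} (hP : ∀ x, 0 < P x) (y : Y) (z : Z) :
    0 ≤ outputKernel W P y z :=
  div_nonneg (outputLaw_nonneg W hP y z) (Finset.sum_nonneg fun _ _ => outputLaw_nonneg W hP _ _)

variable {W}

lemma outputLaw_pos {P : X → ℝ} (hP : ∀ x, 0 < P x) {x : X} {y : Y} {z : Z}
    (h : 0 < (W x : Y × Z → ℝ) (y, z)) : 0 < outputLaw W P y z :=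
  (mul_pos (hP x) h).trans_le (Finset.single_le_sum
    (f := fun x => P x * (W x : Y × Z → ℝ) (y, z))
    (fun x _ => mul_nonneg (hP x).le ((W x).2.1 _)) (Finset.mem_univ x))

lemma sum_outputLaw_pos {P : X → ℝ} (hP : ∀ x, 0 < P x) {x : X} {y : Y} {z : Z}
    (h : 0 < (W x : Y × Z → ℝ) (y, z)) : 0 < ∑ y', outputLaw W P y' z :=
  (outputLaw_pos hP h).trans_le (Finset.single_le_sum (f := fun y => outputLaw W P y z)
    (fun _ _ => outputLaw_nonneg W hP _ _) (Finset.mem_univ y))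

lemma outputKernel_pos {P : X → ℝ} (hP : ∀ x, 0 < P x) {x : X} {y : Y} {z : Z}
    (h : 0 < (W x : Y × Z → ℝ) (y, z)) : 0 < outputKernel W P y z :=
  div_pos (outputLaw_pos hP h) (sum_outputLaw_pos hP h)

variable (W)

lemma sum_eavesdropperLaw_mul_outputKernel {P : X → ℝ} (hP : ∀ x, 0 < P x) (x : X) :
    ∑ y, ∑ z, eavesdropperLaw W x z * outputKernel W P y z = 1 := by
  rw [Finset.sum_comm, ← channel_sum W x, Finset.sum_comm (γ := Y)]
  refine Finset.sum_congr rfl fun z _ => ?_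
  rw [← Finset.mul_sum]
  change _ = eavesdropperLaw W x z
  -- The kernel is `0 / 0 = 0` at a `z` that never occurs, so it need not sum to one there; such a
  -- `z` has zero weight.
  rcases (eavesdropperLaw_nonneg W x z).eq_or_lt with h | h
  · rw [← h, zero_mul]
  · obtain ⟨y, -, hy⟩ := Finset.exists_lt_of_sum_lt (s := Finset.univ) (f := fun _ : Y => (0 : ℝ))
      (g := fun y => (W x : Y × Z → ℝ) (y, z)) (by simpa [eavesdropperLaw] using h)
    unfold outputKernel
    rw [← Finset.sum_div, div_self (sum_outputLaw_pos hP hy).ne', mul_one]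

/-- The channel that degrades the eavesdropper's output by `outputKernel W P`. -/
noncomputable def degradedChannel {P : X → ℝ} (hP : ∀ x, 0 < P x) (x : X) :
    stdSimplex ℝ (Y × Z) :=
  ⟨fun a => eavesdropperLaw W x a.2 * outputKernel W P a.1 a.2,
    fun _ => mul_nonneg (eavesdropperLaw_nonneg W x _) (outputKernel_nonneg W hP _ _), by
      rw [Fintype.sum_prod_type]; exact sum_eavesdropperLaw_mul_outputKernel W hP x⟩

/-- Gibbs' inequality, in a form that allows zeros of the first argument. -/
lemma sub_le_mul_log_div {p q : ℝ} (hp : 0 ≤ p) (hq : 0 ≤ q) (h : 0 < p → 0 < q) :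
    p - q ≤ p * Real.log (p / q) := by
  rcases hp.eq_or_lt with h0 | h0
  · simp [← h0, hq]
  · have hq := h h0
    have := Real.one_sub_inv_le_log_of_pos (div_pos h0 hq)
    calc p - q = p * (1 - (p / q)⁻¹) := by field_simp
      _ ≤ _ := mul_le_mul_of_nonneg_left this h0.le

lemma outputDivergence_nonneg {P : X → ℝ} (hP : ∀ x, 0 < P x) (x : X) :
    0 ≤ outputDivergence W P x := by
  have : ∑ y, ∑ z, ((W x : Y × Z → ℝ) (y, z) - eavesdropperLaw W x z * outputKernel W P y z)
      ≤ outputDivergence W P x :=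
    Finset.sum_le_sum fun y _ => Finset.sum_le_sum fun z _ =>
      sub_le_mul_log_div ((W x).2.1 _)
        (mul_nonneg (eavesdropperLaw_nonneg W x _) (outputKernel_nonneg W hP _ _))
        fun h => mul_pos (eavesdropperLaw_pos h) (outputKernel_pos hP h)
  refine le_trans ?_ this
  simp_rw [Finset.sum_sub_distrib]
  rw [sum_eavesdropperLaw_mul_outputKernel W hP, channel_sum, sub_self]

/-- In each term with `W(y,z|x) > 0` the factor `P x` cancels from the logarithm, leaving the
likelihood ratio of `W` to its degraded version. -/
lemma channelCondMutualInfo_mul_log_two (P : stdSimplex ℝ X) (hP : ∀ x, 0 < (P : X → ℝ) x) :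
    channelCondMutualInfo W P * Real.log 2 = ∑ x, (P : X → ℝ) x * outputDivergence W P x := by
  unfold channelCondMutualInfo condMutualInfo outputDivergence
  rw [Finset.sum_mul]
  refine Finset.sum_congr rfl fun x _ => ?_
  rw [Finset.sum_mul, Finset.mul_sum]
  refine Finset.sum_congr rfl fun y _ => ?_
  rw [Finset.sum_mul, Finset.mul_sum]
  refine Finset.sum_congr rfl fun z _ => ?_
  rw [Real.logb, mul_assoc, div_mul_cancel₀ _ (Real.log_pos one_lt_two).ne', mul_assoc]
  have e1 : ∑ x', ∑ y', (P : X → ℝ) x' * (W x' : Y × Z → ℝ) (y', z)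
      = ∑ y', outputLaw W P y' z := Finset.sum_comm
  rcases (channel_nonneg W x (y, z)).eq_or_lt with h | h
  · have h' : (W x : Y × Z → ℝ) (y, z) = 0 := h.symm
    rw [h']; simp
  · rw [e1, ← Finset.mul_sum]
    change _ * (_ * Real.log (_ / ((P : X → ℝ) x * eavesdropperLaw W x z * outputLaw W P y z))) = _
    have h1 := eavesdropperLaw_pos h
    have h2 := outputLaw_pos hP h
    have h3 := sum_outputLaw_pos hP h
    have h4 := hP x
    congr 3
    unfold outputKernel
    field_simp

/-- The difference of the two sides is the divergence of the output law from the law with the same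
`Z`-marginal and the kernel of `P'`, so the kernel of `P` itself is the best one. The proof uses `1
- 1/t ≤ log t` termwise. -/
lemma sum_mul_outputDivergence_le {P P' : X → ℝ} (hP : ∀ x, 0 < P x) (hP' : ∀ x, 0 < P' x) :
    ∑ x, P x * outputDivergence W P x ≤ ∑ x, P x * outputDivergence W P' x := by
  have key : ∀ x y z, P x * (W x : Y × Z → ℝ) (y, z)
        - P x * ((W x : Y × Z → ℝ) (y, z) * (outputKernel W P' y z / outputKernel W P y z))
      ≤ P x * ((W x : Y × Z → ℝ) (y, z) * Real.log ((W x : Y × Z → ℝ) (y, z) /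
          (eavesdropperLaw W x z * outputKernel W P' y z)))
        - P x * ((W x : Y × Z → ℝ) (y, z) * Real.log ((W x : Y × Z → ℝ) (y, z) /
          (eavesdropperLaw W x z * outputKernel W P y z))) := by
    intro x y z
    rw [← mul_sub, ← mul_sub, ← mul_sub]
    refine mul_le_mul_of_nonneg_left ?_ (hP x).le
    rcases (channel_nonneg W x (y, z)).eq_or_lt with h | h
    · have h' : (W x : Y × Z → ℝ) (y, z) = 0 := h.symm
      rw [h']; simp
    · have h1 := eavesdropperLaw_pos h
      have h2 := outputKernel_pos hP h
      have h3 := outputKernel_pos hP' h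
      rw [← Real.log_div (by positivity) (by positivity)]
      calc _ = (W x : Y × Z → ℝ) (y, z) *
            (1 - (outputKernel W P y z / outputKernel W P' y z)⁻¹) := by
            rw [inv_div]; ring
        _ ≤ (W x : Y × Z → ℝ) (y, z) *
            Real.log (outputKernel W P y z / outputKernel W P' y z) :=
            mul_le_mul_of_nonneg_left (Real.one_sub_inv_le_log_of_pos (by positivity)) h.le
        _ = _ := by rw [div_div_div_eq]; congr 2; field_simp
  have e1 : ∑ x, ∑ y, ∑ z, P x * (W x : Y × Z → ℝ) (y, z) = ∑ z, ∑ y, outputLaw W P y z := by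
    rw [Finset.sum_comm, Finset.sum_congr rfl fun y _ => Finset.sum_comm, Finset.sum_comm]; rfl
  -- An inequality suffices: points of zero output law drop out on the left, and the kernel of `P'`
  -- sums to one or, by `0 / 0 = 0`, to zero.
  have e2 : ∑ x, ∑ y, ∑ z, P x * ((W x : Y × Z → ℝ) (y, z) *
      (outputKernel W P' y z / outputKernel W P y z)) ≤ ∑ z, ∑ y, outputLaw W P y z := by
    rw [Finset.sum_comm, Finset.sum_congr rfl fun y _ => Finset.sum_comm, Finset.sum_comm]
    refine Finset.sum_le_sum fun z _ => ?_
    simp_rw [← mul_assoc, ← Finset.sum_mul]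
    change ∑ y, outputLaw W P y z * _ ≤ _
    have hs : 0 ≤ ∑ y, outputLaw W P y z := Finset.sum_nonneg fun y _ => outputLaw_nonneg W hP y z
    calc ∑ y, outputLaw W P y z * (outputKernel W P' y z / outputKernel W P y z)
        ≤ ∑ y, (∑ y', outputLaw W P y' z) * outputKernel W P' y z := by
          refine Finset.sum_le_sum fun y _ => ?_
          rcases (outputLaw_nonneg W hP y z).eq_or_lt with h | h
          · rw [← h, zero_mul]
            exact mul_nonneg hs (outputKernel_nonneg W hP' y z)
          · have h3 : 0 < ∑ y', outputLaw W P y' z := h.trans_le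
              (Finset.single_le_sum (f := fun y => outputLaw W P y z)
                (fun _ _ => outputLaw_nonneg W hP _ _) (Finset.mem_univ y))
            refine le_of_eq ?_
            conv_lhs => rw [outputKernel.eq_1 W P]
            field_simp
      _ = (∑ y', outputLaw W P y' z) *
            ((∑ y, outputLaw W P' y z) / ∑ y, outputLaw W P' y z) := by
          rw [← Finset.mul_sum]; unfold outputKernel; rw [← Finset.sum_div]
      _ ≤ _ := mul_le_of_le_one_right hs (div_self_le_one _)
  have := Finset.sum_le_sum fun x (_ : x ∈ Finset.univ) => Finset.sum_le_sum
    fun y (_ : y ∈ Finset.univ) => Finset.sum_le_sum fun z (_ : z ∈ Finset.univ) => key x y z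
  simp_rw [Finset.sum_sub_distrib] at this
  unfold outputDivergence
  simp_rw [Finset.mul_sum]
  linarith

lemma continuousAt_outputDivergence {P : X → ℝ} (hP : ∀ x, 0 < P x) (x : X) :
    ContinuousAt (fun P => outputDivergence W P x) P := by
  have hl : ∀ y z, Continuous fun P => outputLaw W P y z := fun y z =>
    continuous_finsetSum _ fun x _ => (continuous_apply x).mul continuous_const
  refine tendsto_finsetSum _ fun y _ => tendsto_finsetSum _ fun z _ => ?_
  rcases (channel_nonneg W x (y, z)).eq_or_lt with h | h
  · have h' : (W x : Y × Z → ℝ) (y, z) = 0 := h.symm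
    simp only [h', zero_mul]
    exact tendsto_const_nhds
  · have h1 := eavesdropperLaw_pos h
    have h2 := outputKernel_pos hP h
    have h3 := sum_outputLaw_pos hP h
    refine ContinuousAt.mul continuousAt_const (ContinuousAt.log ?_ (by positivity))
    refine ContinuousAt.div continuousAt_const (ContinuousAt.mul continuousAt_const ?_)
      (by positivity)
    exact ContinuousAt.div (hl y z).continuousAt
      (continuous_finsetSum _ fun y _ => hl y z).continuousAt h3.ne'

/-- First-order optimality of a maximizer of the conditional mutual information over a convex set
of input laws of full support. -/
lemma sum_mul_outputDivergence_le_of_isMaxOn {S : Set (stdSimplex ℝ X)}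
    (hS : ∀ P ∈ S, ∀ x, 0 < (P : X → ℝ) x) {P₀ P₁ : stdSimplex ℝ X} (h₀ : P₀ ∈ S)
    (hmix : ∀ l : ℝ, 0 < l → l ≤ 1 →
      ∃ P ∈ S, (P : X → ℝ) = (1 - l) • (P₀ : X → ℝ) + l • (P₁ : X → ℝ))
    (hmax : ∀ P ∈ S, channelCondMutualInfo W P ≤ channelCondMutualInfo W P₀) :
    ∑ x, (P₁ : X → ℝ) x * outputDivergence W P₀ x ≤ channelCondMutualInfo W P₀ * Real.log 2 := by
  have hlog : 0 < Real.log 2 := Real.log_pos one_lt_two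
  have hlim : Filter.Tendsto (fun l : ℝ => ∑ x, (P₁ : X → ℝ) x *
      outputDivergence W ((1 - l) • (P₀ : X → ℝ) + l • (P₁ : X → ℝ)) x)
      (nhdsWithin 0 (Set.Ioi 0))
      (nhds (∑ x, (P₁ : X → ℝ) x * outputDivergence W P₀ x)) := by
    refine tendsto_finsetSum _ fun x _ => Filter.Tendsto.const_mul _ ?_
    refine (continuousAt_outputDivergence W (hS P₀ h₀) x).tendsto.comp ?_
    refine Filter.Tendsto.mono_left ?_ nhdsWithin_le_nhds
    have : Continuous fun l : ℝ => (1 - l) • (P₀ : X → ℝ) + l • (P₁ : X → ℝ) := by fun_prop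
    simpa using this.tendsto 0
  -- No derivative is needed. With the kernel of the mixture `P`, the part from `P₀` is at least `(1
  -- - l) I(P₀)` by optimality of the own kernel, while the total is at most `I(P₀)`; cancel, divide
  -- by `l` and let `l → 0`.
  refine le_of_tendsto hlim ?_
  filter_upwards [Ioc_mem_nhdsGT (zero_lt_one' ℝ)] with l hl
  obtain ⟨P, hPS, hP⟩ := hmix l hl.1 hl.2
  have h := mul_le_mul_of_nonneg_right (hmax P hPS) hlog.le
  have h2 := sum_mul_outputDivergence_le W (hS P₀ h₀) (hS P hPS)
  rw [← channelCondMutualInfo_mul_log_two W P₀ (hS P₀ h₀)] at h2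
  rw [channelCondMutualInfo_mul_log_two W P (hS P hPS)] at h
  have e : ∑ x, (P : X → ℝ) x * outputDivergence W P x
      = (1 - l) * ∑ x, (P₀ : X → ℝ) x * outputDivergence W P x
        + l * ∑ x, (P₁ : X → ℝ) x * outputDivergence W P x := by
    rw [Finset.mul_sum, Finset.mul_sum, ← Finset.sum_add_distrib]
    refine Finset.sum_congr rfl fun x _ => ?_
    have : (P : X → ℝ) x = (1 - l) * (P₀ : X → ℝ) x + l * (P₁ : X → ℝ) x := by rw [hP]; simp
    rw [this]; ring
  rw [← hP]
  rw [e] at h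
  have h3 := mul_le_mul_of_nonneg_left h2 (sub_nonneg.2 hl.2)
  have : l * ∑ x, (P₁ : X → ℝ) x * outputDivergence W P x
      ≤ l * (channelCondMutualInfo W P₀ * Real.log 2) := by linarith
  exact le_of_mul_le_mul_left this hl.1

/-- Some input law of full support almost satisfies the Kuhn–Tucker conditions. -/
lemma exists_outputDivergence_le [Nonempty X] {C : ℝ} (hC : ∀ P, channelCondMutualInfo W P ≤ C)
    {g : ℝ} (hg : 0 < g) :
    ∃ P : X → ℝ, (∀ x, 0 < P x) ∧ ∀ x, outputDivergence W P x ≤ C * Real.log 2 + g := by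
  have hlog : 0 < Real.log 2 := Real.log_pos one_lt_two
  -- A maximizer over the whole simplex may lack full support, so masses are kept at least `s`; `s`
  -- is so small that the resulting factor `1 - |X| s` costs at most `g`.
  obtain ⟨s, ⟨hs0, hs1⟩, hsg⟩ : ∃ s : ℝ, (0 < s ∧ Fintype.card X * s < 1) ∧
      C * Real.log 2 ≤ (1 - Fintype.card X * s) * (C * Real.log 2 + g) := by
    have h1 : Filter.Tendsto (fun s : ℝ => (1 - Fintype.card X * s) * (C * Real.log 2 + g))
        (nhdsWithin 0 (Set.Ioi 0)) (nhds (C * Real.log 2 + g)) := by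
      refine Filter.Tendsto.mono_left ?_ nhdsWithin_le_nhds
      have : Continuous fun s : ℝ => (1 - Fintype.card X * s) * (C * Real.log 2 + g) := by
        fun_prop
      simpa using this.tendsto 0
    have h2 : Filter.Tendsto (fun s : ℝ => Fintype.card X * s)
        (nhdsWithin 0 (Set.Ioi 0)) (nhds 0) := by
      refine Filter.Tendsto.mono_left ?_ nhdsWithin_le_nhds
      have : Continuous fun s : ℝ => Fintype.card X * s := by fun_prop
      simpa using this.tendsto 0
    obtain ⟨s, ha, hb, hc⟩ := ((h1.eventually_const_lt (lt_add_of_pos_right _ hg)).and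
      ((h2.eventually_lt_const one_pos).and self_mem_nhdsWithin)).exists
    exact ⟨s, ⟨hc, hb⟩, ha.le⟩
  set k : ℝ := (Fintype.card X : ℝ) with hk
  let S : Set (stdSimplex ℝ X) := {P | ∀ x, s ≤ (P : X → ℝ) x}
  have hSclosed : IsClosed S := by
    have : S = ⋂ x, {P : stdSimplex ℝ X | s ≤ (P : X → ℝ) x} := by ext; simp [S]
    rw [this]
    exact isClosed_iInter fun x => isClosed_le continuous_const
      ((continuous_apply x).comp continuous_subtype_val)
  classical
  -- The vertices of the shrunken simplex; optimality tested towards the vertex at `x` isolates the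
  -- divergence of the input `x`.
  have hvertex : ∀ x : X, ∃ P ∈ S,
      (P : X → ℝ) = fun i => s + (1 - k * s) * (Pi.single x 1 : X → ℝ) i := by
    intro x
    have hn : ∀ i, s ≤ s + (1 - k * s) * (Pi.single x 1 : X → ℝ) i := fun i =>
      le_add_of_nonneg_right (mul_nonneg (by linarith) (by
        by_cases h : i = x
        · subst h; simp
        · simp [h]))
    refine ⟨⟨fun i => s + (1 - k * s) * (Pi.single x 1 : X → ℝ) i, fun i => hs0.le.trans (hn i), ?_⟩,
      hn, rfl⟩
    rw [Finset.sum_add_distrib, ← Finset.mul_sum]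
    simp [hk]
  obtain ⟨x₀⟩ := ‹Nonempty X›
  obtain ⟨P₀, h₀, hmax⟩ := hSclosed.isCompact.exists_isMaxOn
    (let ⟨P, hP, _⟩ := hvertex x₀; ⟨P, hP⟩) (continuous_channelCondMutualInfo W).continuousOn
  have hS : ∀ P ∈ S, ∀ x, 0 < (P : X → ℝ) x := fun P hP x => hs0.trans_le (hP x)
  refine ⟨P₀, hS P₀ h₀, fun x => ?_⟩
  obtain ⟨P₁, h₁, hP₁⟩ := hvertex x
  have h := sum_mul_outputDivergence_le_of_isMaxOn W hS h₀ (by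
    intro l hl0 hl1
    refine ⟨⟨(1 - l) • (P₀ : X → ℝ) + l • (P₁ : X → ℝ),
      convex_stdSimplex ℝ X P₀.2 P₁.2 (by linarith) hl0.le (by ring)⟩, fun i => ?_, rfl⟩
    have := mul_le_mul_of_nonneg_left (h₀ i) (sub_nonneg.2 hl1)
    have := mul_le_mul_of_nonneg_left (h₁ i) hl0.le
    change s ≤ (1 - l) * (P₀ : X → ℝ) i + l * (P₁ : X → ℝ) i
    linarith) hmax
  have hsum : (1 - k * s) * outputDivergence W P₀ x
      ≤ ∑ i, (P₁ : X → ℝ) i * outputDivergence W P₀ i := by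
    rw [hP₁]
    simp_rw [add_mul, mul_assoc, Finset.sum_add_distrib, ← Finset.mul_sum]
    have : 0 ≤ s * ∑ i, outputDivergence W P₀ i := mul_nonneg hs0.le
      (Finset.sum_nonneg fun i _ => outputDivergence_nonneg W (hS P₀ h₀) i)
    simp only [Pi.single_apply, ite_mul, one_mul, zero_mul, Finset.sum_ite_eq', Finset.mem_univ,
      if_true]
    linarith
  have hCle := mul_le_mul_of_nonneg_right (hC P₀) hlog.le
  exact le_of_mul_le_mul_left ((hsum.trans (h.trans hCle)).trans hsg) (by linarith)

/-- A Chernoff-type bound of the exponential moments of the log-likelihood ratio. -/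
lemma exists_sum_mul_rpow_le (V : X → stdSimplex ℝ (Y × Z))
    (hV : ∀ x a, 0 < (W x : Y × Z → ℝ) a → 0 < (V x : Y × Z → ℝ) a) {D g : ℝ} (hg : 0 < g)
    (hD : ∀ x, ∑ y, ∑ z, (W x : Y × Z → ℝ) (y, z) * Real.log ((W x : Y × Z → ℝ) (y, z) /
      (V x : Y × Z → ℝ) (y, z)) ≤ D) :
    ∃ s : ℝ, 0 < s ∧ ∀ x, ∑ y, ∑ z, (W x : Y × Z → ℝ) (y, z) *
      ((W x : Y × Z → ℝ) (y, z) / (V x : Y × Z → ℝ) (y, z)) ^ s ≤ Real.exp (s * (D + g)) := by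
  have key : ∀ x, ∀ᶠ s : ℝ in nhdsWithin 0 (Set.Ioi 0), ∑ y, ∑ z, (W x : Y × Z → ℝ) (y, z) *
      ((W x : Y × Z → ℝ) (y, z) / (V x : Y × Z → ℝ) (y, z)) ^ s ≤ Real.exp (s * (D + g)) := by
    intro x
    -- The moment is `1` at `s = 0` with slope at most `D < D + g`, so for small `s > 0` it is below
    -- `1 + s (D + g)`. Finiteness of `X` then gives one `s` for all inputs.
    have hd : HasDerivAt (fun s : ℝ => ∑ y, ∑ z, (W x : Y × Z → ℝ) (y, z) *
        ((W x : Y × Z → ℝ) (y, z) / (V x : Y × Z → ℝ) (y, z)) ^ s)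
        (∑ y, ∑ z, (W x : Y × Z → ℝ) (y, z) * Real.log ((W x : Y × Z → ℝ) (y, z) /
          (V x : Y × Z → ℝ) (y, z))) 0 := by
      refine HasDerivAt.fun_sum fun y _ => HasDerivAt.fun_sum fun z _ => ?_
      rcases (channel_nonneg W x (y, z)).eq_or_lt with h | h
      · have h' : (W x : Y × Z → ℝ) (y, z) = 0 := h.symm
        simp only [h', zero_mul]
        exact hasDerivAt_const _ _
      · have := (Real.hasStrictDerivAt_const_rpow (div_pos h (hV x _ h)) 0).hasDerivAt.const_mul
          ((W x : Y × Z → ℝ) (y, z))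
        refine this.congr_deriv ?_
        rw [Real.rpow_zero, one_mul]
    have ht := hd.tendsto_slope.mono_left
      (nhdsWithin_mono (0 : ℝ) fun s (hs : s ∈ Set.Ioi 0) => hs.ne')
    filter_upwards [ht.eventually_lt_const ((hD x).trans_lt (lt_add_of_pos_right D hg)),
      self_mem_nhdsWithin] with s h1 h2
    have h2 : 0 < s := h2
    rw [slope_def_field, sub_zero, div_lt_iff₀ h2] at h1
    simp only [Real.rpow_zero, mul_one, channel_sum] at h1
    have := Real.add_one_le_exp (s * (D + g))
    linarith
  obtain ⟨s, h1, h2⟩ := ((Filter.eventually_all.2 key).and self_mem_nhdsWithin).exists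
  exact ⟨s, h2, h1⟩

end OutputKernel

/-! ### Trajectories with adaptive inputs -/

open MeasureTheory

lemma sum_fin_succ_pi {Y : Type*} [Fintype Y] {n : ℕ} (g : (Fin (n + 1) → Y) → ℝ) :
    ∑ y, g y = ∑ a, ∑ y : Fin n → Y, g (Fin.cons a y) := by
  rw [← (Fin.consEquiv fun _ : Fin (n + 1) => Y).sum_comp, Fintype.sum_prod_type]
  rfl

/-- The total weight of the trajectories of a process with adaptive inputs. -/
lemma sum_prod_adaptive_le {X Y Z : Type*} [Fintype Y] [Fintype Z] (h : X → Y → Z → ℝ)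
    (h0 : ∀ x y z, 0 ≤ h x y z) {k : ℝ} (hk : ∀ x, ∑ y, ∑ z, h x y z ≤ k) (hk0 : 0 ≤ k) {n : ℕ}
    (ξ : (Fin n → Y) → Fin n → X)
    (hξ : ∀ y y' t, (∀ i, i < t → y i = y' i) → ξ y t = ξ y' t) :
    ∑ y : Fin n → Y, ∑ z : Fin n → Z, ∏ t, h (ξ y t) (y t) (z t) ≤ k ^ n := by
  induction n with
  | zero => simp
  | succ n ih =>
    simp_rw [sum_fin_succ_pi, Fin.prod_univ_succ, Fin.cons_zero, Fin.cons_succ]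
    rcases isEmpty_or_nonempty Y with hY | ⟨⟨y₀⟩⟩
    · simp [hk0]
    · have e : ∀ y, ξ y 0 = ξ (fun _ => y₀) 0 := fun y =>
        hξ _ _ _ fun i hi => absurd hi (Fin.not_lt_zero i)
      simp_rw [e]
      calc _ = ∑ a, ∑ b, h (ξ (fun _ => y₀) 0) a b * ∑ y : Fin n → Y, ∑ z : Fin n → Z,
              ∏ t, h (ξ (Fin.cons a y) (Fin.succ t)) (y t) (z t) := by
            refine Finset.sum_congr rfl fun a _ => ?_
            rw [Finset.sum_comm]
            simp_rw [Finset.mul_sum]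
        _ ≤ ∑ a, ∑ b, h (ξ (fun _ => y₀) 0) a b * k ^ n := by
            refine Finset.sum_le_sum fun a _ => Finset.sum_le_sum fun b _ =>
              mul_le_mul_of_nonneg_left (ih (fun y t => ξ (Fin.cons a y) t.succ) ?_) (h0 _ _ _)
            intro y y' t ht
            refine hξ _ _ _ fun i hi => ?_
            cases i using Fin.cases with
            | zero => simp
            | succ i => simpa using ht i (by simpa using hi)
        _ ≤ k ^ (n + 1) := by
            simp_rw [← Finset.sum_mul]
            rw [pow_succ']
            exact mul_le_mul_of_nonneg_right (hk _) (pow_nonneg hk0 n)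

lemma sum_prod_adaptive_eq_one {X Y Z : Type*} [Fintype Y] [Fintype Z] (h : X → Y → Z → ℝ)
    (hk : ∀ x, ∑ y, ∑ z, h x y z = 1) {n : ℕ}
    (ξ : (Fin n → Y) → Fin n → X)
    (hξ : ∀ y y' t, (∀ i, i < t → y i = y' i) → ξ y t = ξ y' t) (hX : Nonempty X) :
    ∑ y : Fin n → Y, ∑ z : Fin n → Z, ∏ t, h (ξ y t) (y t) (z t) = 1 := by
  obtain ⟨x₀⟩ := hX
  have hY : Nonempty Y := by
    by_contra hY
    rw [not_nonempty_iff] at hY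
    simpa using hk x₀
  obtain ⟨y₀⟩ := hY
  induction n with
  | zero => simp
  | succ n ih =>
    simp_rw [sum_fin_succ_pi, Fin.prod_univ_succ, Fin.cons_zero, Fin.cons_succ]
    have e : ∀ y, ξ y 0 = ξ (fun _ => y₀) 0 := fun y =>
      hξ _ _ _ fun i hi => absurd hi (Fin.not_lt_zero i)
    simp_rw [e]
    rw [← hk (ξ (fun _ => y₀) 0)]
    refine Finset.sum_congr rfl fun a _ => ?_
    rw [Finset.sum_comm]
    refine Finset.sum_congr rfl fun b _ => ?_
    simp_rw [← Finset.mul_sum]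
    rw [ih (fun y t => ξ (Fin.cons a y) t.succ), mul_one]
    intro y y' t ht
    refine hξ _ _ _ fun i hi => ?_
    cases i using Fin.cases with
    | zero => simp
    | succ i => simpa using ht i (by simpa using hi)

/-! ### Probability calculus of a code and the change of measure -/

namespace WiretapCode

variable {X Y Z : Type*} {N n : ℕ} (c : WiretapCode X Y N n)

/-- Causality, as needed for the bounds on adaptive trajectories. -/
lemma input_congr (m : Fin N) (u : c.T) (v : c.R) (y y' : Fin n → Y) (t : Fin n)
    (h : ∀ i, i < t → y i = y' i) : c.input m u v y t = c.input m u v y' t := by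
  unfold input feedback
  congr 1
  funext i
  congr 1
  funext j
  exact h _ (Fin.lt_def.2 (lt_of_lt_of_le j.2 (Nat.lt_succ_iff.1 i.2)))

/-- The channel inputs when the feedback communication is `f`. -/
def inputOf (m : Fin N) (u : c.T) (f : Fin n → c.F) (t : Fin n) : X :=
  c.enc t m (fun i => f ⟨i, (Nat.lt_succ_iff.mp i.2).trans_lt t.2⟩) u

/-- The inputs involve the outputs and the receiver's randomness only through the public feedback;
the conditional independence under the degraded channel rests on this. -/
lemma input_eq_inputOf (m : Fin N) (u : c.T) (v : c.R) (y : Fin n → Y) (t : Fin n) :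
    c.input m u v y t = c.inputOf m u (c.feedback v y) t := rfl

lemma measurableSet_feedback_eq (y : Fin n → Y) (f : Fin n → c.F) :
    MeasurableSet {v : c.R | c.feedback v y = f} := by
  have : {v : c.R | c.feedback v y = f} = ⋂ t, {v | c.feedback v y t = f t} := by
    ext v; simp [funext_iff]
  rw [this]
  exact MeasurableSet.iInter fun t => c.measurable_fb t _ _

lemma measurableSet_inputOf_eq (m : Fin N) (f : Fin n → c.F) (x : Fin n → X) :
    MeasurableSet {u : c.T | c.inputOf m u f = x} := by
  have : {u : c.T | c.inputOf m u f = x} = ⋂ t, {u | c.inputOf m u f t = x t} := by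
    ext v; simp [funext_iff]
  rw [this]
  exact MeasurableSet.iInter fun t => c.measurable_enc t _ _ _

/-- Once the feedback sequence is fixed, the event is a rectangle in the two local randomnesses;
there are countably many such sequences. -/
lemma measurable_comp_input [Finite X] (m : Fin N) (y : Fin n → Y) (g : (Fin n → X) → ℝ) :
    Measurable fun w : c.T × c.R => g (c.input m w.1 w.2 y) := by
  let : MeasurableSpace (Fin n → X) := ⊤
  refine measurable_from_top.comp (measurable_to_countable' fun x => ?_)
  have : (fun w : c.T × c.R => c.input m w.1 w.2 y) ⁻¹' {x} =
      ⋃ f : Fin n → c.F, {u : c.T | c.inputOf m u f = x} ×ˢ {v | c.feedback v y = f} := by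
    ext w
    simp only [Set.mem_preimage, Set.mem_singleton_iff, Set.mem_iUnion, Set.mem_prod,
      Set.mem_ofPred_eq]
    constructor
    · intro h; exact ⟨_, h, rfl⟩
    · rintro ⟨f, h1, rfl⟩; exact h1
  rw [this]
  exact MeasurableSet.iUnion fun f =>
    (c.measurableSet_inputOf_eq m f x).prod (c.measurableSet_feedback_eq y f)

/-- Events of the random experiment described by a code. -/
abbrev Event (Z : Type*) (c : WiretapCode X Y N n) :=
  Fin N → c.T → c.R → (Fin n → Y) → (Fin n → Z) → Prop

variable {c} in
/-- The events that have a probability. -/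
def MeasurableEvent (E : c.Event Z) : Prop :=
  ∀ m y z, MeasurableSet {w : c.T × c.R | E m w.1 w.2 y z}

variable {c} in
lemma MeasurableEvent.and {E E' : c.Event Z} (h : MeasurableEvent E) (h' : MeasurableEvent E') :
    MeasurableEvent (Z := Z) (c := c) fun m u v y z => E m u v y z ∧ E' m u v y z :=
  fun m y z => (h m y z).inter (h' m y z)

variable [Fintype Y] [Fintype Z] (W : X → stdSimplex ℝ (Y × Z))

/-- The conditional probability of the outputs given the message and the local randomness. -/
noncomputable def weight (m : Fin N) (y : Fin n → Y) (z : Fin n → Z) (w : c.T × c.R) : ℝ :=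
  ∏ t, (W (c.input m w.1 w.2 y t) : Y × Z → ℝ) (y t, z t)

lemma weight_nonneg (m : Fin N) (y : Fin n → Y) (z : Fin n → Z) (w : c.T × c.R) :
    0 ≤ c.weight W m y z w :=
  Finset.prod_nonneg fun _ _ => (W _).2.1 _

lemma weight_le_one (m : Fin N) (y : Fin n → Y) (z : Fin n → Z) (w : c.T × c.R) :
    c.weight W m y z w ≤ 1 :=
  Finset.prod_le_one (fun _ _ => (W _).2.1 _) fun t _ => by
    rw [← (W (c.input m w.1 w.2 y t)).2.2]
    exact Finset.single_le_sum (f := fun a => (W (c.input m w.1 w.2 y t) : Y × Z → ℝ) a)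
      (fun a _ => (W _).2.1 a) (Finset.mem_univ _)

lemma sum_weight (m : Fin N) (w : c.T × c.R) [Nonempty X] :
    ∑ y : Fin n → Y, ∑ z : Fin n → Z, c.weight W m y z w = 1 :=
  sum_prod_adaptive_eq_one (fun x y z => (W x : Y × Z → ℝ) (y, z)) (channel_sum W)
    (fun y => c.input m w.1 w.2 y) (fun y y' t => c.input_congr m w.1 w.2 y y' t) inferInstance

lemma integrable_weight [Finite X] (m : Fin N) (y : Fin n → Y) (z : Fin n → Z) :
    Integrable (c.weight W m y z) (c.lawT.prod c.lawR) := by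
  refine Integrable.of_bound (C := 1) ?_ ?_
  · exact (c.measurable_comp_input m y
      fun x => ∏ t, (W (x t) : Y × Z → ℝ) (y t, z t)).aestronglyMeasurable
  · refine Filter.Eventually.of_forall fun w => ?_
    rw [Real.norm_of_nonneg (c.weight_nonneg W m y z w)]
    exact c.weight_le_one W m y z w

variable {c} {W}

open scoped Classical in
lemma ite_eq_indicator_weight (E : c.Event Z) (m : Fin N) (y : Fin n → Y) (z : Fin n → Z)
    (w : c.T × c.R) : (if E m w.1 w.2 y z then
      ∏ t, (W (c.input m w.1 w.2 y t) : Y × Z → ℝ) (y t, z t) else 0)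
      = {w : c.T × c.R | E m w.1 w.2 y z}.indicator (c.weight W m y z) w := by
  by_cases h : E m w.1 w.2 y z
  · rw [Set.indicator_of_mem (by exact h)]; simp [h, weight]
  · rw [Set.indicator_of_notMem (by exact h)]; simp [h]

lemma prob_eq_sum_setIntegral [Finite X] {E : c.Event Z} (hE : MeasurableEvent E) :
    c.prob W E = (1 / (N : ℝ)) * ∑ m, ∑ y, ∑ z,
      ∫ w in {w : c.T × c.R | E m w.1 w.2 y z}, c.weight W m y z w ∂(c.lawT.prod c.lawR) := by
  classical
  unfold prob
  congr 1
  refine Finset.sum_congr rfl fun m _ => ?_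
  have e : ∀ y z, (fun w : c.T × c.R => if E m w.1 w.2 y z then
      ∏ t, (W (c.input m w.1 w.2 y t) : Y × Z → ℝ) (y t, z t) else 0)
      = {w : c.T × c.R | E m w.1 w.2 y z}.indicator (c.weight W m y z) := by
    intro y z; funext w
    exact ite_eq_indicator_weight E m y z w
  have hi : ∀ y z, Integrable (fun w : c.T × c.R => if E m w.1 w.2 y z then
      ∏ t, (W (c.input m w.1 w.2 y t) : Y × Z → ℝ) (y t, z t) else 0)
      (c.lawT.prod c.lawR) := by
    intro y z; rw [e]; exact (c.integrable_weight W m y z).indicator (hE m y z)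
  have step : ∫ w : c.T × c.R, ∑ y : Fin n → Y, ∑ z : Fin n → Z,
      (if E m w.1 w.2 y z then ∏ t, (W (c.input m w.1 w.2 y t) : Y × Z → ℝ) (y t, z t) else 0)
      ∂(c.lawT.prod c.lawR) = ∑ y : Fin n → Y, ∑ z : Fin n → Z,
      ∫ w, {w : c.T × c.R | E m w.1 w.2 y z}.indicator (c.weight W m y z) w
        ∂(c.lawT.prod c.lawR) := by
    rw [integral_finsetSum _ fun y _ => integrable_finsetSum _ fun z _ => hi y z]
    refine Finset.sum_congr rfl fun y _ => ?_
    rw [integral_finsetSum _ fun z _ => hi y z]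
    refine Finset.sum_congr rfl fun z _ => ?_
    rw [← e]
  refine Eq.trans ?_ (step.trans ?_)
  · congr!
  · exact Finset.sum_congr rfl fun y _ => Finset.sum_congr rfl fun z _ =>
      integral_indicator (hE m y z)

lemma prob_nonneg [Finite X] {E : c.Event Z} (hE : MeasurableEvent E) : 0 ≤ c.prob W E := by
  rw [prob_eq_sum_setIntegral hE]
  exact mul_nonneg (by positivity) (Finset.sum_nonneg fun m _ => Finset.sum_nonneg fun y _ =>
    Finset.sum_nonneg fun z _ => setIntegral_nonneg (hE m y z) fun w _ => c.weight_nonneg W m y z w)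

lemma prob_true [Nonempty X] (hN : N ≠ 0) : c.prob W (fun _ _ _ _ _ => True) = 1 := by
  have h := fun m w => c.sum_weight W m w
  unfold weight at h
  simp only [prob, if_true, h, integral_const, probReal_univ, smul_eq_mul, mul_one,
    Finset.sum_const, Finset.card_univ, Fintype.card_fin, nsmul_eq_mul]
  field_simp

/-- Countable additivity. -/
lemma hasSum_prob [Finite X] {A : Type*} [Countable A]
    (g : Fin N → c.T → c.R → (Fin n → Y) → (Fin n → Z) → A)
    (hg : ∀ a, MeasurableEvent (Z := Z) (c := c) fun m u v y z => g m u v y z = a)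
    {E : c.Event Z} (hE : MeasurableEvent E) :
    HasSum (fun a => c.prob W fun m u v y z => E m u v y z ∧ g m u v y z = a) (c.prob W E) := by
  have hEa := fun a => hE.and (hg a)
  rw [prob_eq_sum_setIntegral hE]
  simp_rw [fun a => prob_eq_sum_setIntegral (W := W) (hEa a)]
  refine HasSum.mul_left _ (hasSum_sum fun m _ => hasSum_sum fun y _ => hasSum_sum fun z _ => ?_)
  have hU : {w : c.T × c.R | E m w.1 w.2 y z}
      = ⋃ a, {w : c.T × c.R | E m w.1 w.2 y z ∧ g m w.1 w.2 y z = a} := by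
    ext w; simp
  rw [hU]
  refine hasSum_integral_iUnion (fun a => hEa a m y z) ?_
    (c.integrable_weight W m y z).integrableOn
  intro a b hab
  refine Set.disjoint_left.2 fun w h1 h2 => hab (h1.2.symm.trans h2.2)

lemma prob_le_add [Finite X] {E E₁ E₂ : c.Event Z} (hE : MeasurableEvent E)
    (hE₁ : MeasurableEvent E₁) (hE₂ : MeasurableEvent E₂)
    (h : ∀ m u v y z, E m u v y z → E₁ m u v y z ∨ E₂ m u v y z) :
    c.prob W E ≤ c.prob W E₁ + c.prob W E₂ := by
  rw [prob_eq_sum_setIntegral hE, prob_eq_sum_setIntegral hE₁, prob_eq_sum_setIntegral hE₂,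
    ← mul_add]
  simp_rw [← Finset.sum_add_distrib]
  refine mul_le_mul_of_nonneg_left (Finset.sum_le_sum fun m _ => Finset.sum_le_sum fun y _ =>
    Finset.sum_le_sum fun z _ => ?_) (by positivity)
  have hi := c.integrable_weight W m y z
  rw [← integral_indicator (hE m y z), ← integral_indicator (hE₁ m y z),
    ← integral_indicator (hE₂ m y z), ← integral_add (hi.indicator (hE₁ m y z))
      (hi.indicator (hE₂ m y z))]
  refine integral_mono (hi.indicator (hE m y z))
    ((hi.indicator (hE₁ m y z)).add (hi.indicator (hE₂ m y z))) fun w => ?_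
  by_cases hw : E m w.1 w.2 y z
  · rw [Set.indicator_of_mem (by exact hw)]
    rcases h _ _ _ _ _ hw with h1 | h1
    · rw [Set.indicator_of_mem (by exact h1)]
      exact le_add_of_nonneg_right (Set.indicator_nonneg (fun _ _ => c.weight_nonneg W m y z _) _)
    · rw [Set.indicator_of_mem (s := {w : c.T × c.R | E₂ m w.1 w.2 y z})
        (by exact h1)]
      exact le_add_of_nonneg_left (Set.indicator_nonneg (fun _ _ => c.weight_nonneg W m y z _) _)
  · rw [Set.indicator_of_notMem (by exact hw)]
    exact add_nonneg (Set.indicator_nonneg (fun _ _ => c.weight_nonneg W m y z _) _)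
      (Set.indicator_nonneg (fun _ _ => c.weight_nonneg W m y z _) _)

/-- Change of measure from `W` to `V`, at the price of the exponential moments of the
log-likelihood ratio. -/
lemma prob_le_change_of_measure [Finite X] [Nonempty X] (hN : N ≠ 0)
    (V : X → stdSimplex ℝ (Y × Z))
    (hV : ∀ x a, 0 < (W x : Y × Z → ℝ) a → 0 < (V x : Y × Z → ℝ) a) {s k L : ℝ} (hs : 0 < s)
    (hk0 : 0 ≤ k) (hk : ∀ x, ∑ y, ∑ z, (W x : Y × Z → ℝ) (y, z) *
      ((W x : Y × Z → ℝ) (y, z) / (V x : Y × Z → ℝ) (y, z)) ^ s ≤ k) (hL : 0 < L)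
    {E : c.Event Z} (hE : MeasurableEvent E) :
    c.prob W E ≤ k ^ n / L ^ s + L * c.prob V E := by
  classical
  -- Pointwise Markov inequality: if the likelihood ratio of the trajectory exceeds `L`, its `s`-th
  -- power divided by `L ^ s` is at least one.
  have hpt : ∀ m y z w, c.weight W m y z w ≤ L * c.weight V m y z w +
      (∏ t, (W (c.input m w.1 w.2 y t) : Y × Z → ℝ) (y t, z t) *
        ((W (c.input m w.1 w.2 y t) : Y × Z → ℝ) (y t, z t) /
          (V (c.input m w.1 w.2 y t) : Y × Z → ℝ) (y t, z t)) ^ s) / L ^ s := by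
    intro m y z w
    have hr : ∀ t, 0 ≤ (W (c.input m w.1 w.2 y t) : Y × Z → ℝ) (y t, z t) /
          (V (c.input m w.1 w.2 y t) : Y × Z → ℝ) (y t, z t) := fun t =>
      div_nonneg ((W _).2.1 _) ((V _).2.1 _)
    have e : ∏ t, (W (c.input m w.1 w.2 y t) : Y × Z → ℝ) (y t, z t) *
        ((W (c.input m w.1 w.2 y t) : Y × Z → ℝ) (y t, z t) /
          (V (c.input m w.1 w.2 y t) : Y × Z → ℝ) (y t, z t)) ^ s
        = c.weight W m y z w * (c.weight W m y z w / c.weight V m y z w) ^ s := by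
      rw [Finset.prod_mul_distrib, Real.finsetProd_rpow _ _ fun t _ => hr t, Finset.prod_div_distrib]
      rfl
    rw [e]
    have hw0 := c.weight_nonneg W m y z w
    have hv0 := c.weight_nonneg V m y z w
    have hLs : 0 < L ^ s := Real.rpow_pos_of_pos hL s
    by_cases hle : c.weight W m y z w ≤ L * c.weight V m y z w
    · exact hle.trans (le_add_of_nonneg_right (div_nonneg (mul_nonneg hw0
        (Real.rpow_nonneg (div_nonneg hw0 hv0) s)) hLs.le))
    · push Not at hle
      have hwpos : 0 < c.weight W m y z w := (mul_nonneg hL.le hv0).trans_lt hle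
      have hvpos : 0 < c.weight V m y z w := by
        refine Finset.prod_pos fun t ht => hV _ _ ?_
        refine lt_of_le_of_ne ((W _).2.1 _) fun h => hwpos.ne' ?_
        exact Finset.prod_eq_zero ht h.symm
      have h1 : L ^ s ≤ (c.weight W m y z w / c.weight V m y z w) ^ s :=
        Real.rpow_le_rpow hL.le ((le_div_iff₀ hvpos).2 hle.le) hs.le
      have h2 : c.weight W m y z w ≤ c.weight W m y z w *
          (c.weight W m y z w / c.weight V m y z w) ^ s / L ^ s := by
        rw [le_div_iff₀ hLs]; exact mul_le_mul_of_nonneg_left h1 hw0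
      exact h2.trans (le_add_of_nonneg_left (mul_nonneg hL.le hv0))
  have hLs : 0 < L ^ s := Real.rpow_pos_of_pos hL s
  have hN' : (0 : ℝ) < N := by exact_mod_cast Nat.pos_of_ne_zero hN
  -- The tilted products are again weights of adaptive trajectories, now with one-step mass at most
  -- `k`.
  have hpath : ∀ m (w : c.T × c.R), ∑ y : Fin n → Y, ∑ z : Fin n → Z,
      (∏ t, (W (c.input m w.1 w.2 y t) : Y × Z → ℝ) (y t, z t) *
        ((W (c.input m w.1 w.2 y t) : Y × Z → ℝ) (y t, z t) /
          (V (c.input m w.1 w.2 y t) : Y × Z → ℝ) (y t, z t)) ^ s) ≤ k ^ n := fun m w =>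
    sum_prod_adaptive_le (fun x y z => (W x : Y × Z → ℝ) (y, z) *
      ((W x : Y × Z → ℝ) (y, z) / (V x : Y × Z → ℝ) (y, z)) ^ s)
      (fun x y z => mul_nonneg ((W x).2.1 _)
        (Real.rpow_nonneg (div_nonneg ((W x).2.1 _) ((V x).2.1 _)) s)) hk hk0
      (fun y => c.input m w.1 w.2 y) (fun y y' t => c.input_congr m w.1 w.2 y y' t)
  have hint : ∀ (K : X → stdSimplex ℝ (Y × Z)) m, Integrable (fun w : c.T × c.R =>
      ∑ y, ∑ z, {w : c.T × c.R | E m w.1 w.2 y z}.indicator (c.weight K m y z) w)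
      (c.lawT.prod c.lawR) := fun K m =>
    integrable_finsetSum _ fun y _ => integrable_finsetSum _ fun z _ =>
      (c.integrable_weight K m y z).indicator (hE m y z)
  have hprob : ∀ K : X → stdSimplex ℝ (Y × Z), c.prob K E = (1 / (N : ℝ)) * ∑ m,
      ∫ w, ∑ y, ∑ z, {w : c.T × c.R | E m w.1 w.2 y z}.indicator (c.weight K m y z) w
        ∂(c.lawT.prod c.lawR) := by
    intro K
    unfold prob
    simp_rw [← ite_eq_indicator_weight]
  have hm : ∀ m, ∫ w, ∑ y, ∑ z,
        {w : c.T × c.R | E m w.1 w.2 y z}.indicator (c.weight W m y z) w ∂(c.lawT.prod c.lawR)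
      ≤ k ^ n / L ^ s + L * ∫ w, ∑ y, ∑ z,
        {w : c.T × c.R | E m w.1 w.2 y z}.indicator (c.weight V m y z) w
          ∂(c.lawT.prod c.lawR) := by
    intro m
    have hc : ∫ _ : c.T × c.R, k ^ n / L ^ s ∂(c.lawT.prod c.lawR) = k ^ n / L ^ s := by simp
    rw [← integral_const_mul, ← hc, ← integral_add (integrable_const _)
      ((hint V m).const_mul L)]
    refine integral_mono (hint W m) ((integrable_const _).add ((hint V m).const_mul L)) fun w => ?_
    have h1 : ∑ y, ∑ z,
        {w : c.T × c.R | E m w.1 w.2 y z}.indicator (c.weight W m y z) w ≤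
        ∑ y : Fin n → Y, ∑ z : Fin n → Z,
          (L * {w : c.T × c.R | E m w.1 w.2 y z}.indicator (c.weight V m y z) w +
      (∏ t, (W (c.input m w.1 w.2 y t) : Y × Z → ℝ) (y t, z t) *
        ((W (c.input m w.1 w.2 y t) : Y × Z → ℝ) (y t, z t) /
          (V (c.input m w.1 w.2 y t) : Y × Z → ℝ) (y t, z t)) ^ s) / L ^ s) := by
      refine Finset.sum_le_sum fun y _ => Finset.sum_le_sum fun z _ => ?_
      by_cases hw : E m w.1 w.2 y z
      · rw [Set.indicator_of_mem (by exact hw), Set.indicator_of_mem (by exact hw)]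
        exact hpt m y z w
      · rw [Set.indicator_of_notMem (by exact hw), Set.indicator_of_notMem (by exact hw),
          mul_zero, zero_add]
        exact div_nonneg (Finset.prod_nonneg fun t _ => mul_nonneg ((W _).2.1 _)
          (Real.rpow_nonneg (div_nonneg ((W _).2.1 _) ((V _).2.1 _)) s)) hLs.le
    refine h1.trans ?_
    simp_rw [Finset.sum_add_distrib, ← Finset.sum_div, ← Finset.mul_sum]
    rw [add_comm]
    exact add_le_add_left (div_le_div_of_nonneg_right (hpath m w) hLs.le) _
  rw [hprob W, hprob V]
  calc _ ≤ (1 / (N : ℝ)) * ∑ m : Fin N, (k ^ n / L ^ s + L * ∫ w, ∑ y, ∑ z,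
        {w : c.T × c.R | E m w.1 w.2 y z}.indicator (c.weight V m y z) w
          ∂(c.lawT.prod c.lawR)) :=
        mul_le_mul_of_nonneg_left (Finset.sum_le_sum fun m _ => hm m) (by positivity)
    _ = _ := by
        rw [Finset.sum_add_distrib, ← Finset.mul_sum]
        simp only [Finset.sum_const, Finset.card_univ, Fintype.card_fin, nsmul_eq_mul]
        field_simp

end WiretapCode

/-! ### Counting likely agreements, and events under variation distance -/

/-- Only a few `m` can have a large product of conditional probabilities `a m * b m`. -/
lemma card_mul_le_one_of_lt_mul {ι : Type*} [Fintype ι] {a b : ι → ℝ} (ha : ∀ i, 0 ≤ a i)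
    (hb : ∀ i, 0 ≤ b i) {t : ℝ} (S : Finset ι)
    (hS : ∀ i ∈ S, t ^ 2 * ((∑ j, a j) * ∑ j, b j) < a i * b i) : (S.card : ℝ) * t ≤ 1 := by
  rcases S.eq_empty_or_nonempty with rfl | ⟨i, hi⟩
  · simp
  have hA : 0 ≤ ∑ j, a j := Finset.sum_nonneg fun j _ => ha j
  have hB : 0 ≤ ∑ j, b j := Finset.sum_nonneg fun j _ => hb j
  have hpos : 0 < a i * b i := lt_of_le_of_lt (by positivity) (hS i hi)
  have hAB : 0 < (∑ j, a j) * ∑ j, b j := hpos.trans_le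
    (mul_le_mul (Finset.single_le_sum (fun j _ => ha j) (Finset.mem_univ i))
      (Finset.single_le_sum (fun j _ => hb j) (Finset.mem_univ i)) (hb i) hA)
  -- Every element of `S` contributes at least `t √(AB)` to `∑ √a √b`, where `A` and `B` are the two
  -- total masses, and Cauchy–Schwarz bounds that sum by `√(AB)`.
  have h1 : (S.card : ℝ) * (t * √((∑ j, a j) * ∑ j, b j)) ≤ ∑ j ∈ S, √(a j) * √(b j) := by
    rw [← nsmul_eq_mul]
    refine Finset.card_nsmul_le_sum _ _ _ fun j hj => ?_
    rw [← Real.sqrt_mul (ha j)]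
    refine Real.le_sqrt_of_sq_le ?_
    rw [mul_pow, Real.sq_sqrt hAB.le]
    exact (hS j hj).le
  have h2 : ∑ j ∈ S, √(a j) * √(b j) ≤ √((∑ j, a j) * ∑ j, b j) := by
    rw [Real.sqrt_mul hA]
    refine (Finset.sum_le_univ_sum_of_nonneg fun j => by positivity).trans ?_
    exact Real.sum_sqrt_mul_sqrt_le _ (fun j => ha j) (fun j => hb j)
  have h3 := h1.trans h2
  rw [← mul_assoc] at h3
  exact (mul_le_iff_le_one_left (Real.sqrt_pos.2 hAB)).1 h3

/-- On and off `S`, the difference of the indicators is at most `(|p - q| + (p - q)) / 2`; the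
signed part sums to zero because both masses are one. -/
lemma le_add_of_variationDist_le {A : Type*} {p q : A → ℝ} (hp : HasSum p 1) (hq : HasSum q 1)
    {δ : ℝ} (h : variationDist p q ≤ δ) (S : Set A) :
    ∑' a, S.indicator p a ≤ δ + ∑' a, S.indicator q a := by
  have hpS := hp.summable.indicator S
  have hqS := hq.summable.indicator S
  have habs : Summable fun a => |p a - q a| := (hp.summable.sub hq.summable).abs
  have h1 : ∑' a, (S.indicator p a - S.indicator q a)
      ≤ ∑' a, (1 / 2 * |p a - q a| + 1 / 2 * (p a - q a)) := by
    refine (hpS.sub hqS).tsum_le_tsum (fun a => ?_)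
      ((habs.mul_left _).add ((hp.summable.sub hq.summable).mul_left _))
    have h1 := le_abs_self (p a - q a)
    have h2 := neg_abs_le (p a - q a)
    by_cases ha : a ∈ S
    · rw [Set.indicator_of_mem ha, Set.indicator_of_mem ha]; linarith
    · rw [Set.indicator_of_notMem ha, Set.indicator_of_notMem ha]; linarith
  rw [hpS.tsum_sub hqS, (habs.mul_left _).tsum_add ((hp.summable.sub hq.summable).mul_left _),
    tsum_mul_left, tsum_mul_left, hp.summable.tsum_sub hq.summable, hp.tsum_eq, hq.tsum_eq] at h1
  unfold variationDist at h
  linarith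

/-! ### Factorization over a degraded channel -/

namespace WiretapCode

variable {X Y Z : Type*} {N n : ℕ}

/-- Such an event is a countable union of cells on which the decoded message and the feedback are
constant. -/
lemma measurableEvent_of_public (c : WiretapCode X Y N n)
    (p : Fin N → Fin N → (Fin n → Z) → (Fin n → c.F) → Prop) :
    MeasurableEvent (Z := Z) (c := c) fun m _ v y z => p m (c.dec y v) z (c.feedback v y) := by
  intro m y z
  have : {w : c.T × c.R | p m (c.dec y w.2) z (c.feedback w.2 y)}
      = Prod.snd ⁻¹' ⋃ a ∈ {a : Fin N × (Fin n → c.F) | p m a.1 z a.2},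
        {v | c.dec y v = a.1} ∩ {v | c.feedback v y = a.2} := by
    ext w; simp
  rw [this]
  exact measurable_snd (MeasurableSet.biUnion (Set.to_countable _) fun a _ =>
    (c.measurable_dec y a.1).inter (c.measurableSet_feedback_eq y a.2))

section Factorization

variable (c : WiretapCode X Y N n) (A : X → Z → ℝ) (B : Y → Z → ℝ)

/-- The conditional weight of the eavesdropper's outputs given the message and the feedback. -/
noncomputable def messageWeight (a : (Fin n → Z) × (Fin n → c.F)) (m : Fin N) : ℝ :=
  ∫ u, ∏ t, A (c.inputOf m u a.2 t) (a.1 t) ∂c.lawT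

/-- The weight of the feedback and the decoded message given the eavesdropper's outputs. -/
noncomputable def decodedWeight [Fintype Y] (a : (Fin n → Z) × (Fin n → c.F)) (k : Fin N) : ℝ :=
  ∑ y : Fin n → Y, c.lawR.real {v | c.feedback v y = a.2 ∧ c.dec y v = k} * ∏ t, B (y t) (a.1 t)

variable {A B}

lemma messageWeight_nonneg (hA : ∀ x z, 0 ≤ A x z) (a : (Fin n → Z) × (Fin n → c.F)) (m : Fin N) :
    0 ≤ c.messageWeight A a m :=
  integral_nonneg fun _ => Finset.prod_nonneg fun _ _ => hA _ _

lemma decodedWeight_nonneg [Fintype Y] (hB : ∀ y z, 0 ≤ B y z)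
    (a : (Fin n → Z) × (Fin n → c.F)) (k : Fin N) : 0 ≤ c.decodedWeight B a k :=
  Finset.sum_nonneg fun _ _ => mul_nonneg measureReal_nonneg (Finset.prod_nonneg fun _ _ => hB _ _)

/-- Over a channel with conditionally independent outputs, the message and the decoded message are
conditionally independent given the eavesdropper's observations. -/
lemma prob_and_public_eq [Finite X] [Fintype Y] [Fintype Z] {V : X → stdSimplex ℝ (Y × Z)}
    (hV : ∀ x y z, (V x : Y × Z → ℝ) (y, z) = A x z * B y z) (S : Fin N → Fin N → Prop)
    [∀ m k, Decidable (S m k)] (a : (Fin n → Z) × (Fin n → c.F)) :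
    c.prob V (fun m _ v y z => S m (c.dec y v) ∧ (z, c.feedback v y) = a)
      = (1 / (N : ℝ)) * ∑ m, ∑ k,
        if S m k then c.messageWeight A a m * c.decodedWeight B a k else 0 := by
  rw [prob_eq_sum_setIntegral (measurableEvent_of_public c fun m k z f => S m k ∧ (z, f) = a)]
  congr 1
  refine Finset.sum_congr rfl fun m _ => ?_
  have hms : ∀ y, MeasurableSet {v : c.R | S m (c.dec y v) ∧ c.feedback v y = a.2} := by
    intro y
    have : {v : c.R | S m (c.dec y v) ∧ c.feedback v y = a.2}
        = (⋃ k ∈ {k | S m k}, {v | c.dec y v = k}) ∩ {v | c.feedback v y = a.2} := by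
      ext v; simp
    rw [this]
    exact (MeasurableSet.biUnion (Set.to_countable _) fun k _ => c.measurable_dec y k).inter
      (c.measurableSet_feedback_eq y a.2)
  have hy : ∀ y, ∑ z, ∫ w in {w : c.T × c.R | S m (c.dec y w.2) ∧ (z, c.feedback w.2 y) = a},
        c.weight V m y z w ∂(c.lawT.prod c.lawR)
      = c.messageWeight A a m * (c.lawR.real {v | S m (c.dec y v) ∧ c.feedback v y = a.2} *
        ∏ t, B (y t) (a.1 t)) := by
    intro y
    rw [Finset.sum_eq_single a.1]
    · have hset : {w : c.T × c.R | S m (c.dec y w.2) ∧ (a.1, c.feedback w.2 y) = a}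
          = Prod.snd ⁻¹' {v | S m (c.dec y v) ∧ c.feedback v y = a.2} := by
        ext w; simp [Prod.ext_iff]
      rw [hset, ← integral_indicator (measurable_snd (hms y))]
      -- With the feedback frozen at `a.2` the inputs depend on the transmitter's randomness alone,
      -- so the integrand is a function of `u` times a function of `v`.
      have hfun : (Prod.snd ⁻¹' {v | S m (c.dec y v) ∧ c.feedback v y = a.2}).indicator
          (c.weight V m y a.1) = fun w : c.T × c.R =>
            (∏ t, A (c.inputOf m w.1 a.2 t) (a.1 t)) *
            {v | S m (c.dec y v) ∧ c.feedback v y = a.2}.indicator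
              (fun _ => ∏ t, B (y t) (a.1 t)) w.2 := by
        funext w
        by_cases hw : S m (c.dec y w.2) ∧ c.feedback w.2 y = a.2
        · rw [Set.indicator_of_mem (by exact hw), Set.indicator_of_mem (by exact hw)]
          unfold weight
          simp_rw [input_eq_inputOf, hw.2, hV, Finset.prod_mul_distrib]
        · rw [Set.indicator_of_notMem (by exact hw), Set.indicator_of_notMem (by exact hw),
            mul_zero]
      rw [hfun, integral_prod_mul (fun u => ∏ t, A (c.inputOf m u a.2 t) (a.1 t)),
        integral_indicator (hms y), setIntegral_const, smul_eq_mul]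
      rfl
    · intro z _ hz
      have : {w : c.T × c.R | S m (c.dec y w.2) ∧ (z, c.feedback w.2 y) = a} = ∅ := by
        ext w
        simp only [Set.mem_ofPred_eq, Set.mem_empty_iff_false, iff_false, not_and]
        rintro - rfl
        exact hz rfl
      rw [this, setIntegral_empty]
    · simp
  simp_rw [hy]
  have hk : ∀ y, c.lawR.real {v | S m (c.dec y v) ∧ c.feedback v y = a.2}
      = ∑ k, if S m k then c.lawR.real {v | c.feedback v y = a.2 ∧ c.dec y v = k} else 0 := by
    intro y
    rw [← Finset.sum_filter, ← measureReal_biUnion_finset]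
    · congr 1
      ext v
      simp only [Set.mem_ofPred_eq, Set.mem_iUnion, Finset.mem_filter, Finset.mem_univ, true_and,
        exists_prop]
      constructor
      · rintro ⟨h1, h2⟩; exact ⟨_, h1, h2, rfl⟩
      · rintro ⟨k, h1, h2, rfl⟩; exact ⟨h1, h2⟩
    · intro i _ j _ hij
      exact Set.disjoint_left.2 fun v h1 h2 => hij (h1.2.symm.trans h2.2)
    · exact fun k _ => (c.measurableSet_feedback_eq y a.2).inter (c.measurable_dec y k)
  simp_rw [hk, ← Finset.mul_sum, Finset.sum_mul]
  rw [Finset.sum_comm, Finset.mul_sum]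
  refine Finset.sum_congr rfl fun k _ => ?_
  by_cases h : S m k
  · simp only [h, if_true]; rfl
  · simp [h]

end Factorization

/-! ### The one-shot converse -/

section Converse

variable [Fintype Y] [Fintype Z] (c : WiretapCode X Y N n)
  (W : X → stdSimplex ℝ (Y × Z))

lemma lawM_eq [Nonempty X] (m : Fin N) : c.lawM W m = 1 / (N : ℝ) := by
  classical
  have h : c.lawM W m = (1 / (N : ℝ)) * ∑ m' : Fin N, if m' = m then 1 else 0 := by
    unfold lawM prob
    congr 1
    refine Finset.sum_congr rfl fun m' _ => ?_
    by_cases hm : m' = m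
    · have h := c.sum_weight W m'
      unfold weight at h
      simp [hm]
      simp [hm ▸ h]
    · simp [hm]
  simpa using h

lemma hasSum_lawZF [Finite X] [Nonempty X] (hN : N ≠ 0) : HasSum (c.lawZF W) 1 := by
  have h := hasSum_prob (W := W) (c := c) (fun _ _ v y z => (z, c.feedback v y))
    (fun a => c.measurableEvent_of_public fun _ _ z f => (z, f) = a)
    (c.measurableEvent_of_public (Z := Z) fun _ _ _ _ => True)
  rw [prob_true hN] at h
  convert h using 2 with a
  unfold lawZF
  simp [Prod.ext_iff]

lemma hasSum_lawMZF_indicator [Finite X] (S : Set (Fin N × (Fin n → Z) × (Fin n → c.F))) :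
    HasSum (S.indicator (c.lawMZF W))
      (c.prob W fun m _ v y z => (m, z, c.feedback v y) ∈ S) := by
  classical
  have h := hasSum_prob (W := W) (c := c) (fun m _ v y z => (m, z, c.feedback v y))
    (fun a => c.measurableEvent_of_public fun m _ z f => (m, z, f) = a)
    (c.measurableEvent_of_public (Z := Z) fun m _ z f => (m, z, f) ∈ S)
  convert h using 2 with a
  by_cases ha : a ∈ S
  · rw [Set.indicator_of_mem ha]
    unfold lawMZF
    congr 1
    funext m u v y z
    rw [eq_iff_iff]
    constructor
    · rintro ⟨rfl, rfl, h⟩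
      have : (a.1, a.2.1, c.feedback v y) = a := by rw [h]
      exact ⟨this ▸ ha, this⟩
    · rintro ⟨-, rfl⟩; exact ⟨rfl, rfl, rfl⟩
  · rw [Set.indicator_of_notMem ha]
    have : (fun m (_ : c.T) v y z => (m, z, c.feedback v y) ∈ S ∧ (m, z, c.feedback v y) = a)
        = fun _ _ _ _ _ => False := by
      funext m u v y z
      rw [eq_iff_iff, iff_false]
      rintro ⟨h, rfl⟩
      exact ha h
    rw [this]
    simp [prob]

variable {c W}

/-- The probability of an event of the message and the eavesdropper's observations that, for fixed
observations, contains few messages. -/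
lemma prob_public_le [Finite X] [Nonempty X] (hN : N ≠ 0) {ε δ η : ℝ} (hc : c.IsGood W ε δ)
    (S : Set (Fin N × (Fin n → Z) × (Fin n → c.F)))
    (hS : ∀ a, ∑ m, S.indicator (fun _ => (1 : ℝ)) (m, a) ≤ N * η) :
    c.prob W (fun m _ v y z => (m, z, c.feedback v y) ∈ S) ≤ δ + η := by
  have hN' : (0 : ℝ) < N := by exact_mod_cast Nat.pos_of_ne_zero hN
  have hp : HasSum (c.lawMZF W) 1 := by
    simpa [prob_true hN] using c.hasSum_lawMZF_indicator W Set.univ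
  have hZF := c.hasSum_lawZF W hN
  have hZF0 : ∀ a, 0 ≤ c.lawZF W a := fun a =>
    prob_nonneg (c.measurableEvent_of_public fun _ _ z f => z = a.1 ∧ f = a.2)
  have hqs : Summable fun a : Fin N × (Fin n → Z) × (Fin n → c.F) =>
      c.lawM W a.1 * c.lawZF W a.2 :=
    Summable.mul_of_nonneg (Summable.of_finite) hZF.summable
      (fun m => by rw [lawM_eq]; positivity) hZF0
  have hq : HasSum (fun a : Fin N × (Fin n → Z) × (Fin n → c.F) =>
      c.lawM W a.1 * c.lawZF W a.2) 1 := by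
    rw [hqs.hasSum_iff, hqs.tsum_prod, tsum_fintype]
    simp only [lawM_eq, tsum_mul_left, hZF.tsum_eq, Finset.sum_const, Finset.card_univ,
      Fintype.card_fin, nsmul_eq_mul]
    field_simp
  -- Passing to the product law costs `δ`; there the message is uniform and independent of the
  -- observations, so a set with at most `N η` messages per observation has mass at most `η`.
  have h := le_add_of_variationDist_le hp hq hc.2 S
  rw [(c.hasSum_lawMZF_indicator W S).tsum_eq] at h
  refine h.trans (add_le_add_right ?_ δ)
  have hqS := hqs.indicator S
  rw [hqS.tsum_prod, tsum_fintype, ← Summable.tsum_finsetSum fun m _ => hqS.prod_factor m]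
  have hb : ∀ a, ∑ m, S.indicator (fun a : Fin N × (Fin n → Z) × (Fin n → c.F) =>
      c.lawM W a.1 * c.lawZF W a.2) (m, a) ≤ η * c.lawZF W a := by
    intro a
    have e : ∀ m, S.indicator (fun a : Fin N × (Fin n → Z) × (Fin n → c.F) =>
        c.lawM W a.1 * c.lawZF W a.2) (m, a)
        = S.indicator (fun _ => (1 : ℝ)) (m, a) * (1 / N * c.lawZF W a) := by
      intro m
      by_cases hm : (m, a) ∈ S
      · rw [Set.indicator_of_mem hm, Set.indicator_of_mem hm, lawM_eq, one_mul]
      · rw [Set.indicator_of_notMem hm, Set.indicator_of_notMem hm, zero_mul]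
    simp_rw [e, ← Finset.sum_mul]
    calc _ ≤ (N * η) * (1 / N * c.lawZF W a) :=
          mul_le_mul_of_nonneg_right (hS a) (mul_nonneg (by positivity) (hZF0 a))
      _ = _ := by field_simp
  calc _ ≤ ∑' a, η * c.lawZF W a := (summable_sum fun m _ => hqS.prod_factor m).tsum_le_tsum hb
        (hZF.summable.mul_left η)
    _ = η := by rw [tsum_mul_left, hZF.tsum_eq, mul_one]

/-- A one-shot converse: the performance of a code is compared with a channel whose outputs are
conditionally independent given the eavesdropper's observations. -/
lemma one_le_of_isGood [Nonempty X] [Finite X] (hN : N ≠ 0) {ε δ η : ℝ} (hc : c.IsGood W ε δ)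
    (hη : 0 < η) {V : X → stdSimplex ℝ (Y × Z)} {A : X → Z → ℝ} {B : Y → Z → ℝ} (hA : ∀ x z, 0 ≤ A x z)
    (hB : ∀ y z, 0 ≤ B y z) (hVAB : ∀ x y z, (V x : Y × Z → ℝ) (y, z) = A x z * B y z)
    (hV : ∀ x a, 0 < (W x : Y × Z → ℝ) a → 0 < (V x : Y × Z → ℝ) a) {s k L : ℝ} (hs : 0 < s)
    (hk0 : 0 ≤ k) (hk : ∀ x, ∑ y, ∑ z, (W x : Y × Z → ℝ) (y, z) *
      ((W x : Y × Z → ℝ) (y, z) / (V x : Y × Z → ℝ) (y, z)) ^ s ≤ k) (hL : 0 < L) :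
    1 ≤ ε + δ + η + k ^ n / L ^ s + L / (N * η ^ 2) := by
  classical
  have hN' : (0 : ℝ) < N := by exact_mod_cast Nat.pos_of_ne_zero hN
  have ha := c.messageWeight_nonneg hA
  have hb := c.decodedWeight_nonneg hB
  set α := c.messageWeight A with hα
  set β := c.decodedWeight B with hβ
  -- Chosen so that the counting bound `card * t ≤ 1` reads `card ≤ N η`.
  let t : ℝ := 1 / (N * η)
  have ht : 0 < t := by positivity
  let S : Set (Fin N × (Fin n → Z) × (Fin n → c.F)) :=
    {a | t ^ 2 * ((∑ j, α a.2 j) * ∑ j, β a.2 j) < α a.2 a.1 * β a.2 a.1}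
  have hS := prob_public_le hN (η := η) hc S (by
    intro a
    have h := card_mul_le_one_of_lt_mul (ha a) (hb a)
      (Finset.univ.filter fun m => (m, a) ∈ S) (by
        intro m hm
        exact (Finset.mem_filter.1 hm).2)
    have e : ∑ m, S.indicator (fun _ => (1 : ℝ)) (m, a)
        = ((Finset.univ.filter fun m => (m, a) ∈ S).card : ℝ) := by
      simp [Set.indicator_apply]
    rw [e]
    rwa [mul_one_div, div_le_one (by positivity)] at h)
  -- Correct decoding of a message that the observations do not favour; the other two possibilities,
  -- an error and a message in `S`, cost `ε` and `δ + η`.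
  let E : c.Event Z := fun m _ v y z => m = c.dec y v ∧ (m, z, c.feedback v y) ∉ S
  have hE : MeasurableEvent E :=
    c.measurableEvent_of_public fun m k z f => m = k ∧ (m, z, f) ∉ S
  have hsplit : 1 ≤ c.errorProb W + (c.prob W (fun m _ v y z => (m, z, c.feedback v y) ∈ S)
      + c.prob W E) := by
    rw [← prob_true (c := c) (W := W) hN]
    have h1 := prob_le_add (W := W) (c.measurableEvent_of_public fun _ _ _ _ => True)
      (c.measurableEvent_of_public (Z := Z) fun m k _ _ => m ≠ k)
      (c.measurableEvent_of_public (Z := Z) fun m k _ _ => m = k)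
      (fun m u v y z _ => (ne_or_eq m (c.dec y v)))
    have h2 := prob_le_add (W := W) (c.measurableEvent_of_public fun m k _ _ => m = k)
      (c.measurableEvent_of_public (Z := Z) fun m _ z f => (m, z, f) ∈ S) hE
      (fun m u v y z h => (em ((m, z, c.feedback v y) ∈ S)).imp_right fun h' => ⟨h, h'⟩)
    exact h1.trans (add_le_add_right h2 _)
  -- For each observation `a`, every one of the `N` messages contributes at most `t²` times `(∑ α)(∑
  -- β)`, and the `V`-probability of `a` is `(∑ α)(∑ β) / N`.
  have hVE : c.prob V E ≤ t ^ 2 * N := by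
    have h1 := hasSum_prob (W := V) (fun _ _ v y z => (z, c.feedback v y))
      (fun a => c.measurableEvent_of_public fun _ _ z f => (z, f) = a) hE
    have h2 := hasSum_prob (W := V) (fun _ _ v y z => (z, c.feedback v y))
      (fun a => c.measurableEvent_of_public fun _ _ z f => (z, f) = a)
      (c.measurableEvent_of_public (Z := Z) fun _ _ _ _ => True)
    rw [prob_true hN] at h2
    have h3 := h2.mul_left (t ^ 2 * N)
    rw [mul_one] at h3
    refine hasSum_le (fun a => ?_) h1 h3
    have e1 : (fun m u v y z => E m u v y z ∧ (z, c.feedback v y) = a)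
        = fun m _ v y z => (m = c.dec y v ∧ (m, a) ∉ S) ∧ (z, c.feedback v y) = a := by
      funext m u v y z
      rw [eq_iff_iff]
      constructor
      · rintro ⟨h, rfl⟩; exact ⟨h, rfl⟩
      · rintro ⟨h, rfl⟩; exact ⟨h, rfl⟩
    rw [e1, c.prob_and_public_eq hVAB (fun m k => m = k ∧ (m, a) ∉ S),
      c.prob_and_public_eq hVAB (fun _ _ => True), ← hα, ← hβ]
    simp only [if_true, ← Finset.mul_sum, ← Finset.sum_mul]
    have hm : ∀ m : Fin N, (∑ k, if m = k ∧ (m, a) ∉ S then α a m * β a k else 0)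
        ≤ t ^ 2 * ((∑ j, α a j) * ∑ j, β a j) := by
      intro m
      by_cases hm : (m, a) ∈ S
      · simp only [hm, not_true_eq_false, and_false, if_false, Finset.sum_const_zero]
        exact mul_nonneg (by positivity) (mul_nonneg (Finset.sum_nonneg fun j _ => ha a j)
          (Finset.sum_nonneg fun j _ => hb a j))
      · simp only [hm, not_false_eq_true, and_true, Finset.sum_ite_eq, Finset.mem_univ, if_true]
        exact not_lt.1 hm
    calc _ ≤ (1 / (N : ℝ)) * ∑ m : Fin N, t ^ 2 * ((∑ j, α a j) * ∑ j, β a j) :=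
          mul_le_mul_of_nonneg_left (Finset.sum_le_sum fun m _ => hm m) (by positivity)
      _ = _ := by
          simp only [Finset.sum_const, Finset.card_univ, Fintype.card_fin, nsmul_eq_mul]
          ring
  have hchange := prob_le_change_of_measure hN V hV hs hk0 hk hL hE
  have hfin : L * c.prob V E ≤ L / (N * η ^ 2) := by
    calc L * c.prob V E ≤ L * (t ^ 2 * N) := mul_le_mul_of_nonneg_left hVE hL.le
      _ = _ := by simp only [t]; field_simp
  have herr := hc.1
  linarith

end Converse

end WiretapCode

/-! ### Asymptotics and the theorem -/

lemma le_of_isAchievableRate {X Y Z : Type*} [Fintype X] [Nonempty X] [Fintype Y] [Fintype Z]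
    {W : X → stdSimplex ℝ (Y × Z)} {ε δ C R : ℝ} (hεδ : ε + δ < 1)
    (hC : ∀ P, channelCondMutualInfo W P ≤ C) (hR : IsAchievableRate W ε δ R) : R ≤ C := by
  by_contra! hlt
  have hlog : 0 < Real.log 2 := Real.log_pos one_lt_two
  -- The gap is spent in four parts: the approximate Kuhn–Tucker point, the exponential moment, the
  -- threshold `L = exp (n (D + 2 g))` above that moment, and the decay of `L / N`.
  obtain ⟨g, hg, hgR⟩ : ∃ g : ℝ, 0 < g ∧ C * Real.log 2 + 4 * g = R * Real.log 2 :=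
    ⟨(R - C) * Real.log 2 / 4, by have := sub_pos.2 hlt; positivity, by ring⟩
  obtain ⟨P, hP, hD⟩ := exists_outputDivergence_le W hC hg
  have hV : ∀ x a, 0 < (W x : Y × Z → ℝ) a → 0 < (degradedChannel W hP x : Y × Z → ℝ) a :=
    fun x a h => mul_pos (eavesdropperLaw_pos (y := a.1) h) (outputKernel_pos hP (y := a.1) h)
  obtain ⟨s, hs, hk⟩ := exists_sum_mul_rpow_le W (degradedChannel W hP) hV hg hD
  obtain ⟨η, hη, hη'⟩ : ∃ η : ℝ, 0 < η ∧ ε + δ + η < 1 :=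
    ⟨(1 - (ε + δ)) / 2, by linarith, by linarith⟩
  set D := C * Real.log 2 + g with hDdef
  have hbound : ∀ᶠ n : ℕ in Filter.atTop, 1 ≤ ε + δ + η + Real.exp (-(s * g) * n)
      + 2 / η ^ 2 * Real.exp (-g * n) := by
    filter_upwards [hR.2] with n ⟨c, hc⟩
    have hx : (2 : ℝ) ^ ((n : ℝ) * R) = Real.exp (n * (R * Real.log 2)) := by
      rw [Real.rpow_def_of_pos two_pos]; congr 1; ring
    have h1 : 1 ≤ (2 : ℝ) ^ ((n : ℝ) * R) :=
      Real.one_le_rpow one_le_two (mul_nonneg (Nat.cast_nonneg n) hR.1.le)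
    have hN1 : 1 ≤ ⌊(2 : ℝ) ^ ((n : ℝ) * R)⌋₊ := Nat.one_le_floor_iff _ |>.2 h1
    have hN2 := Nat.lt_floor_add_one ((2 : ℝ) ^ ((n : ℝ) * R))
    set N := ⌊(2 : ℝ) ^ ((n : ℝ) * R)⌋₊
    have hN1' : (1 : ℝ) ≤ N := by exact_mod_cast hN1
    rw [hx] at hN2
    have hL : 0 < Real.exp (n * (D + 2 * g)) := Real.exp_pos _
    have h := WiretapCode.one_le_of_isGood (by omega) hc hη (eavesdropperLaw_nonneg W)
      (outputKernel_nonneg W hP) (fun _ _ _ => rfl) hV hs (Real.exp_pos _).le hk hL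
    have e1 : Real.exp (s * (D + g)) ^ n / Real.exp (n * (D + 2 * g)) ^ s
        = Real.exp (-(s * g) * n) := by
      rw [← Real.exp_nat_mul, ← Real.exp_mul, ← Real.exp_sub]; congr 1; ring
    -- The factor `2` pays for the floor: `2 ^ (n R) < N + 1 ≤ 2 N`.
    have e2 : Real.exp (n * (D + 2 * g)) / (N * η ^ 2) ≤ 2 / η ^ 2 * Real.exp (-g * n) := by
      rw [div_le_iff₀ (by positivity)]
      have : Real.exp (n * (D + 2 * g)) = Real.exp (-g * n) * Real.exp (n * (R * Real.log 2)) := by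
        rw [← Real.exp_add, ← hgR, hDdef]; congr 1; ring
      rw [this]
      calc _ ≤ Real.exp (-g * n) * (2 * N) :=
            mul_le_mul_of_nonneg_left (by linarith) (Real.exp_pos _).le
        _ = _ := by field_simp
    rw [e1] at h
    linarith
  have hlim : ∀ a : ℝ, 0 < a → Filter.Tendsto (fun n : ℕ => Real.exp (-a * n)) Filter.atTop
      (nhds 0) := fun a ha =>
    Real.tendsto_exp_atBot.comp
      (tendsto_natCast_atTop_atTop.const_mul_atTop_of_neg (neg_lt_zero.2 ha))
  have ht := ((hlim (s * g) (by positivity)).const_add (ε + δ + η)).add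
    ((hlim g hg).const_mul (2 / η ^ 2))
  -- In the limit `1 ≤ ε + δ + η`, against the choice of `η`.
  have := ge_of_tendsto ht hbound
  linarith

theorem theorem1 {X Y Z : Type*} [Fintype X] [Nonempty X] [Fintype Y] [Fintype Z]
    (W : X → stdSimplex ℝ (Y × Z)) (ε δ : ℝ) (hε : 0 ≤ ε) (hδ : 0 ≤ δ) (hεδ : ε + δ < 1) :
    ∃ C : ℝ, IsGreatest (Set.range (channelCondMutualInfo W)) C ∧
      wiretapCapacity W ε δ ≤ ENNReal.ofReal C := by
  classical
  obtain ⟨x₀⟩ := id ‹Nonempty X›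
  have : Nonempty (stdSimplex ℝ X) := ⟨⟨Pi.single x₀ 1, single_mem_stdSimplex ℝ x₀⟩⟩
  obtain ⟨P, -, hP⟩ := isCompact_univ.exists_isMaxOn Set.univ_nonempty
    (continuous_channelCondMutualInfo W).continuousOn
  have hmax : ∀ Q, channelCondMutualInfo W Q ≤ channelCondMutualInfo W P :=
    fun Q => hP (Set.mem_univ Q)
  refine ⟨channelCondMutualInfo W P, ⟨⟨P, rfl⟩, ?_⟩, ?_⟩
  · rintro _ ⟨Q, rfl⟩
    exact hmax Q
  · exact iSup₂_le fun R hR => ENNReal.ofReal_le_ofReal (le_of_isAchievableRate hεδ hmax hR)
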